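/- Let $P$ be a field and $\Theta=\text{Lie-}P$ the variety of all Lie algebras over $P$. Fix an infinite set $X^0$. For a finite subset $X\subset X^0$ let $W(X)$ be the free Lie algebra over $P$ on $X$, and let $\Theta^0$ be the category of the algebras $W(X)$ and all Lie algebra homomorphisms between them. Let $H$ be a Lie algebra over $P$. For a set $T\subset W(X)\times W(X)$ put $T'_H=\{\mu\in \mathrm{Hom}(W(X),H) : \mu(w)=\mu(w') \text{ for all } (w,w')\in T\}$, and let $T''_H=\bigcap_{\mu\in T'_H}\mathrm{Ker}\,\mu$, where $\mathrm{Ker}\,\mu=\{(w,w'):\mu(w)=\mu(w')\}$. The sets of the form $T'_H$ are the algebraic sets in the affine space $\mathrm{Hom}(W(X),H)$. The category $K_\Theta(H)$ has as objects the pairs $(X,A)$ with $A$ an algebraic set in $\mathrm{Hom}(W(X),H)$, and as morphisms $(X,A)\to(Y,B)$ the maps $A\to B$ of the form $\nu\mapsto\nu s$ for some homomorphism $s:W(Y)\to W(X)$. Lie algebras $H_1,H_2$ over $P$ are geometrically equivalent if $T''_{H_1}=T''_{H_2}$ for all finite $X\subset X^0$ and all $T\subset W(X)\times W(X)$. They are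 twisted geometrically equivalent if, for some $\sigma\in\mathrm{Aut}(P)$, $H_1^\sigma$ and $H_2$ are geometrically equivalent; here $H_1^\sigma$ is $H_1$ with the scalar multiplication replaced by $\lambda\circ a=\sigma^{-1}(\lambda)a$. A functor $F:K_\Theta(H_1)\to K_\Theta(H_2)$ is induced on affine spaces by $\varphi:\Theta^0\to\Theta^0$ if, strictly on objects and morphisms, it takes $(X,\mathrm{Hom}(W(X),H_1))$ to $(Y,\mathrm{Hom}(W(Y),H_2))$ with $W(Y)=\varphi(W(X))$, and the morphism $\nu\mapsto\nu s$ to $\nu\mapsto\nu\varphi(s)$. It respects inclusions if $F(X,A_1)=(Y_1,B_1)$, $F(X,A_2)=(Y_2,B_2)$ and $A_1\subset A_2$ imply $Y_1=Y_2$ and $B_1\subset B_2$. An isomorphism $F$ of these categories is correct if it is induced on affine spaces by an automorphism of $\Theta^0$ and respects inclusions. An equivalence $(F,G)$ of these categories is correct if $F$ and $G$ are induced on affine spaces by the two functors of an autoequivalence $(\varphi,\psi)$ of $\Theta^0$ and both respect inclusions. Theorem. Let $H_1,H_2$ be Lie algebras over $P$ with $\mathrm{Var}(H_1)=\mathrm{Var}(H_2)=\text{Lie-}P$,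 i.e. every Lie algebra over $P$ satisfies all identities of $H_1$, and likewise all identities of $H_2$. Then the following conditions are equivalent: 1. the categories $K_\Theta(H_1)$ and $K_\Theta(H_2)$ are isomorphic; 2. the categories $K_\Theta(H_1)$ and $K_\Theta(H_2)$ are equivalent; 3. $H_1$ and $H_2$ are twisted geometrically equivalent; 4. $K_\Theta(H_1)$ and $K_\Theta(H_2)$ are correctly isomorphic; 5. $K_\Theta(H_1)$ and $K_\Theta(H_2)$ are correctly equivalent. -/

import Mathlib

open CategoryTheory

universe u v w a

/-! ### The variety of all Lie algebras over `P` and the condition `Var(H) = Lie-P` -/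

section Varieties

variable (P : Type u) [Field P]

/-- The pair `(w₁, w₂)` of Lie polynomials in countably many variables is an identity of `H`. -/
def IsLieIdentity (H : Type v) [LieRing H] [LieAlgebra P H] (w₁ w₂ : FreeLieAlgebra P ℕ) : Prop :=
  ∀ f : FreeLieAlgebra P ℕ →ₗ⁅P⁆ H, f w₁ = f w₂

/-- `L` belongs to the variety `Var(H)`: it satisfies all identities of `H`. -/
def MemVar (H : Type v) [LieRing H] [LieAlgebra P H]
    (L : Type w) [LieRing L] [LieAlgebra P L] : Prop :=
  ∀ w₁ w₂ : FreeLieAlgebra P ℕ, IsLieIdentity P H w₁ w₂ → IsLieIdentity P L w₁ w₂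

/-- `Var(H) = Lie-P`: every Lie algebra over `P` lies in `Var(H)`. The universe of the test
algebras `L` does not matter, see `VarEqLie.memVar`. -/
def VarEqLie (H : Type v) [LieRing H] [LieAlgebra P H] : Prop :=
  ∀ (L : Type u) [LieRing L] [LieAlgebra P L], MemVar P H L

theorem VarEqLie.memVar {H : Type v} [LieRing H] [LieAlgebra P H] (h : VarEqLie P H)
    (L : Type w) [LieRing L] [LieAlgebra P L] : MemVar P H L := by
  intro w₁ w₂ hw f
  have h1 : w₁ = w₂ := h (FreeLieAlgebra P ℕ) w₁ w₂ hw LieHom.id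
  rw [h1]

end Varieties

/-! ### Equations, points, closures -/

section Galois

variable {P : Type u} [Field P]

/-- `T'_H`: the points `μ : W(X) → H` which are solutions of the system of equations `T`. -/
def solutions (H : Type v) [LieRing H] [LieAlgebra P H] {X : Type a}
    (T : Set (FreeLieAlgebra P X × FreeLieAlgebra P X)) : Set (FreeLieAlgebra P X →ₗ⁅P⁆ H) :=
  {μ | ∀ p ∈ T, μ p.1 = μ p.2}

/-- `A'_W`: the intersection of the kernel congruences of the points in `A`. -/
def commonKer {H : Type v} [LieRing H] [LieAlgebra P H] {X : Type a}
    (A : Set (FreeLieAlgebra P X →ₗ⁅P⁆ H)) : Set (FreeLieAlgebra P X × FreeLieAlgebra P X) :=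
  {p | ∀ μ ∈ A, μ p.1 = μ p.2}

/-- `T''_H`, the `H`-closure of a system of equations. -/
def eqClosure (H : Type v) [LieRing H] [LieAlgebra P H] {X : Type a}
    (T : Set (FreeLieAlgebra P X × FreeLieAlgebra P X)) :
    Set (FreeLieAlgebra P X × FreeLieAlgebra P X) :=
  commonKer (solutions H T)

/-- `A` is a (closed) algebraic set. -/
def IsAlgebraicSet {H : Type v} [LieRing H] [LieAlgebra P H] {X : Type a}
    (A : Set (FreeLieAlgebra P X →ₗ⁅P⁆ H)) : Prop :=
  ∃ T : Set (FreeLieAlgebra P X × FreeLieAlgebra P X), A = solutions H T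

theorem isAlgebraicSet_univ {H : Type v} [LieRing H] [LieAlgebra P H] {X : Type a} :
    IsAlgebraicSet (Set.univ : Set (FreeLieAlgebra P X →ₗ⁅P⁆ H)) :=
  ⟨∅, by ext μ; simp [solutions]⟩

end Galois

/-! ### Twisted algebras and (twisted) geometrical equivalence -/

section Twist

/-- The underlying set of `H^σ` is that of `H`. -/
def Twist {P : Type u} [Field P] (_σ : P ≃+* P) (H : Type v) : Type v := H

variable {P : Type u} [Field P] (σ : P ≃+* P) (H : Type v) [LieRing H] [LieAlgebra P H]

instance : LieRing (Twist σ H) := inferInstanceAs (LieRing H)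

/-- The scalar multiplication of `H^σ` is `c ∘ x = σ⁻¹(c) • x`. -/
instance : Module P (Twist σ H) :=
  @Module.compHom P P H _ _ (inferInstanceAs (Module P H)) _ (σ.symm : P →+* P)

instance : LieAlgebra P (Twist σ H) where
  lie_smul c x y := LieAlgebra.lie_smul (R := P) (L := H) (σ.symm c) x y

/-- Geometrical equivalence: the closures of every system of equations in every `W(X)` with `X` a
finite subset of `𝒰` coincide. -/
def GeomEquiv (P : Type u) [Field P] (𝒰 : Type a)
    (H₁ : Type v) [LieRing H₁] [LieAlgebra P H₁]
    (H₂ : Type w) [LieRing H₂] [LieAlgebra P H₂] : Prop :=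
  ∀ (X : Finset 𝒰) (T : Set (FreeLieAlgebra P X × FreeLieAlgebra P X)),
    eqClosure H₁ T = eqClosure H₂ T

/-- Twisted geometrical equivalence: `H₁^σ` and `H₂` are geometrically equivalent for some
automorphism `σ` of the field `P`. -/
def TwistedGeomEquiv (P : Type u) [Field P] (𝒰 : Type a)
    (H₁ : Type v) [LieRing H₁] [LieAlgebra P H₁]
    (H₂ : Type w) [LieRing H₂] [LieAlgebra P H₂] : Prop :=
  ∃ σ : P ≃+* P, GeomEquiv P 𝒰 (Twist σ H₁) H₂

end Twist

/-! ### The categories `Θ⁰` and `K_Θ(H)` for `Θ = Lie-P` -/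

section Categories

/-- Objects of `Θ⁰`: the free Lie algebras `W(X)`, `X` a finite subset of `𝒰`. -/
structure FreeLieCat (P : Type u) (𝒰 : Type a) where
  vars : Finset 𝒰

/-- The algebra `W(X)`. -/
abbrev FreeLieCat.W {P : Type u} [Field P] {𝒰 : Type a} (X : FreeLieCat P 𝒰) : Type (max u a) :=
  FreeLieAlgebra P X.vars

/-- Morphisms of `Θ⁰` are all homomorphisms of Lie algebras. -/
noncomputable instance (P : Type u) [Field P] (𝒰 : Type a) : Category (FreeLieCat P 𝒰) where
  Hom X Y := X.W →ₗ⁅P⁆ Y.W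
  id _ := LieHom.id
  comp f g := g.comp f

/-- Objects of `K_Θ(H)`: pairs `(X, A)` with `A` an algebraic set in `Hom(W(X), H)`. -/
structure AlgSetCat (P : Type u) [Field P] (𝒰 : Type a)
    (H : Type v) [LieRing H] [LieAlgebra P H] where
  vars : Finset 𝒰
  pts : Set (FreeLieAlgebra P vars →ₗ⁅P⁆ H)
  isAlgebraic : IsAlgebraicSet pts

variable {P : Type u} [Field P] {𝒰 : Type a}

/-- Morphisms `[s] : (X, A) → (Y, B)`: the maps `A → B` of the form `ν ↦ ν ∘ s` for a homomorphism
`s : W(Y) → W(X)`. -/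
instance (H : Type v) [LieRing H] [LieAlgebra P H] : Category (AlgSetCat P 𝒰 H) where
  Hom V V' := {f : V.pts → V'.pts //
    ∃ s : FreeLieAlgebra P V'.vars →ₗ⁅P⁆ FreeLieAlgebra P V.vars,
      ∀ ν : V.pts, (f ν).1 = ν.1.comp s}
  id V := ⟨id, LieHom.id, fun _ => rfl⟩
  comp f g := ⟨g.1 ∘ f.1, by
    obtain ⟨f, s, hs⟩ := f
    obtain ⟨g, t, ht⟩ := g
    exact ⟨s.comp t, fun ν => by
      simp only [Function.comp_apply, ht, hs]
      rfl⟩⟩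

/-- The contravariant functor `Θ⁰ → K_Θ(H)` taking `W(X)` to the affine space `(X, Hom(W(X), H))`
and `s` to `ν ↦ ν ∘ s`. Its image is the subcategory `K⁰_Θ(H)` of affine spaces, and under the
duality of `K_Θ(H)` with the category of coordinate algebras it corresponds, when
`Var(H) = Θ`, to the inclusion of `Θ⁰`. -/
noncomputable def affineSpace (P : Type u) [Field P] (𝒰 : Type a)
    (H : Type v) [LieRing H] [LieAlgebra P H] : (FreeLieCat P 𝒰)ᵒᵖ ⥤ AlgSetCat P 𝒰 H where
  obj X := ⟨X.unop.vars, Set.univ, isAlgebraicSet_univ⟩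
  map {X Y} s := ⟨fun ν => ⟨LieHom.comp ν.1 (s.unop : Y.unop.W →ₗ⁅P⁆ X.unop.W), trivial⟩,
    s.unop, fun _ => rfl⟩

/-- `V = (X, A)` and `V' = (X, A')` with the same `X` and `A ⊆ A'`. -/
def AlgSetCat.Incl {H : Type v} [LieRing H] [LieAlgebra P H] (V V' : AlgSetCat P 𝒰 H) : Prop :=
  ∃ (X : Finset 𝒰) (A A' : Set (FreeLieAlgebra P X →ₗ⁅P⁆ H))
    (hA : IsAlgebraicSet A) (hA' : IsAlgebraicSet A'),
    V = ⟨X, A, hA⟩ ∧ V' = ⟨X, A', hA'⟩ ∧ A ⊆ A'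

end Categories

/-! ### Isomorphism and equivalence of categories of algebraic sets -/

section Correctness

/-- Isomorphism of categories (mutually inverse functors). -/
def AreIsomorphic (C : Type*) [Category C] (D : Type*) [Category D] : Prop :=
  ∃ (F : C ⥤ D) (G : D ⥤ C), F ⋙ G = 𝟭 C ∧ G ⋙ F = 𝟭 D

/-- Equivalence of categories. -/
def AreEquivalent (C : Type*) [Category C] (D : Type*) [Category D] : Prop :=
  Nonempty (C ≌ D)

variable {P : Type u} [Field P] {𝒰 : Type a}
  {H₁ : Type v} [LieRing H₁] [LieAlgebra P H₁] {H₂ : Type w} [LieRing H₂] [LieAlgebra P H₂]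

/-- `F` takes affine spaces to affine spaces, and on them it is the functor induced by the
endofunctor `φ` of `Θ⁰`. -/
def InducedBy (F : AlgSetCat P 𝒰 H₁ ⥤ AlgSetCat P 𝒰 H₂)
    (φ : FreeLieCat P 𝒰 ⥤ FreeLieCat P 𝒰) : Prop :=
  affineSpace P 𝒰 H₁ ⋙ F = φ.op ⋙ affineSpace P 𝒰 H₂

/-- `F` respects inclusions of algebraic sets in the same affine space. -/
def PreservesIncl (F : AlgSetCat P 𝒰 H₁ ⥤ AlgSetCat P 𝒰 H₂) : Prop :=
  ∀ V V' : AlgSetCat P 𝒰 H₁, V.Incl V' → (F.obj V).Incl (F.obj V')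

/-- `K_Θ(H₁)` and `K_Θ(H₂)` are correctly isomorphic: there is an isomorphism which induces an
automorphism of `Θ⁰` and respects inclusions of algebraic sets. -/
def CorrectlyIsomorphic (P : Type u) [Field P] (𝒰 : Type a)
    (H₁ : Type v) [LieRing H₁] [LieAlgebra P H₁]
    (H₂ : Type w) [LieRing H₂] [LieAlgebra P H₂] : Prop :=
  ∃ (F : AlgSetCat P 𝒰 H₁ ⥤ AlgSetCat P 𝒰 H₂) (G : AlgSetCat P 𝒰 H₂ ⥤ AlgSetCat P 𝒰 H₁)
    (φ ψ : FreeLieCat P 𝒰 ⥤ FreeLieCat P 𝒰),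
    (F ⋙ G = 𝟭 _ ∧ G ⋙ F = 𝟭 _) ∧ (φ ⋙ ψ = 𝟭 _ ∧ ψ ⋙ φ = 𝟭 _) ∧
      InducedBy F φ ∧ PreservesIncl F

/-- `K_Θ(H₁)` and `K_Θ(H₂)` are correctly equivalent: there is an equivalence `(F, G)` which
induces an autoequivalence `(φ, ψ)` of `Θ⁰` and respects inclusions of algebraic sets. -/
def CorrectlyEquivalent (P : Type u) [Field P] (𝒰 : Type a)
    (H₁ : Type v) [LieRing H₁] [LieAlgebra P H₁]
    (H₂ : Type w) [LieRing H₂] [LieAlgebra P H₂] : Prop :=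
  ∃ (e : AlgSetCat P 𝒰 H₁ ≌ AlgSetCat P 𝒰 H₂) (ε : FreeLieCat P 𝒰 ≌ FreeLieCat P 𝒰),
    InducedBy e.functor ε.functor ∧ InducedBy e.inverse ε.inverse ∧
      PreservesIncl e.functor ∧ PreservesIncl e.inverse

end Correctness

/-!
The substance of the theorem is that an equivalence `K_Θ(H₁) ≌ K_Θ(H₂)` forces `H₁` and `H₂` to be
twisted geometrically equivalent.

*From the equivalence to bijections of `W(X)`.* When `Var(H) = Lie-P`, morphisms from the affine
space of `X` to the affine line are the same as elements of `W(X)` (`AlgSetCat.coordEquiv`). An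
equivalence takes the affine line to the affine line: all nonzero endomorphisms of the line are
invertible, and every nonzero object has a nonzero morphism to it (`nonempty_iso_of_equivalence`).
Affine spaces are powers of the line, so they are preserved together with their projections. Hence
the equivalence yields bijections `s_X : W(X) → W(X)` which fix the variables and are compatible with
substitutions (`AlgSetCat.exists_isSubstitutive`), and which transform closures into closures,
because the closure has a description in terms of morphisms (`AlgSetCat.mem_eqClosure_iff`).

*The bijections are semilinear.* Compatibility with substitutions gives `s (b + c) = p(s b, s c)` and
`s ⁅b, c⁆ = q(s b, s c)` for fixed Lie polynomials `p` and `q` in two variables. The claim is that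
`p = x + y` and `q = κ ⁅x, y⁆`, over any field, finite ones included
(`FreeLieAlgebra.eq_add_of_group_law`, `FreeLieAlgebra.eq_smul_lie_of_additive`). Evaluate them in a
split extension `L ⋉ M` with an abelian ideal `M`. For `m ∈ M` the value `p(b, m)` is
`b + f(ad b) m` with a polynomial `f` in one variable; the group law makes `f(ad b)` invertible, so
`f = 1`. Associativity then gives `p(a, b + m) = p(a, b) + m`, and comparison with the effect of an
inner automorphism defined by `m` (`SplitExt.conj`) gives `(p - x - y) m = 0`. Similarly `q(b, m) = f(ad b) m`, where
`f` is additive on noncommuting operators, and so is linear.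

*Faithfulness.* To conclude one needs an `m` which is not annihilated by any nonzero element of
`W(X)`. A new free variable is such an `m` (`FreeLieAlgebra.eq_zero_of_lie_new_eq_zero`). This takes
the place of the Poincaré-Birkhoff-Witt theorem, and is proved by induction on the degree: the
elimination theorem identifies the ideal of `W(X)` generated by the variables `y ≠ x` with the free
Lie algebra on the elements `(ad x)^i y`, and this lowers the degree of the part of an element which
involves `x`.

*From the twist to correct isomorphisms.* If `σ` is the automorphism of `P`, the `σ`-semilinear
automorphisms of the algebras `W(X)` which fix the variables transform `H₁`-closures into
`H₂`-closures. Applied to the equations of algebraic sets they define a functor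
(`AlgSetCat.twistFunctor`), whose inverse is the functor of the inverse automorphisms.
-/

/-! ### Split extensions of Lie algebras by modules -/

/-- The split extension `L ⋉ M` of a Lie algebra `L` by an `L`-module `M`, which becomes an abelian
ideal: the bracket is `⁅(a, m), (b, n)⁆ = (⁅a, b⁆, a • n - b • m)`. -/
@[ext] structure SplitExt (L : Type*) (M : Type*) where
  /-- the component in `L` -/
  fst : L
  /-- the component in `M` -/
  snd : M

namespace SplitExt

variable {R L M : Type*}

/-- The underlying set of `L ⋉ M` is `L × M`. -/
def toProd : SplitExt L M ≃ L × M where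
  toFun a := (a.fst, a.snd)
  invFun a := ⟨a.1, a.2⟩

/-- The inclusion of the abelian ideal `M` in `L ⋉ M`. -/
def inr (L : Type*) {M : Type*} [Zero L] (m : M) : SplitExt L M := ⟨0, m⟩

@[simp] theorem fst_inr [Zero L] (m : M) : (inr L m).1 = 0 := rfl
@[simp] theorem snd_inr [Zero L] (m : M) : (inr L m).2 = m := rfl

section

variable [CommRing R] [AddCommGroup L] [Module R L] [AddCommGroup M] [Module R M]

instance : AddCommGroup (SplitExt L M) := toProd.addCommGroup
instance : Module R (SplitExt L M) := toProd.module R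

@[simp] theorem fst_add (a b : SplitExt L M) : (a + b).1 = a.1 + b.1 := rfl
@[simp] theorem snd_add (a b : SplitExt L M) : (a + b).2 = a.2 + b.2 := rfl
@[simp] theorem snd_neg (a : SplitExt L M) : (-a).2 = -a.2 := rfl
@[simp] theorem fst_zero : (0 : SplitExt L M).1 = 0 := rfl
@[simp] theorem snd_zero : (0 : SplitExt L M).2 = 0 := rfl
@[simp] theorem fst_smul (r : R) (a : SplitExt L M) : (r • a).1 = r • a.1 := rfl
@[simp] theorem snd_smul (r : R) (a : SplitExt L M) : (r • a).2 = r • a.2 := rfl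

end

variable [CommRing R] [LieRing L] [LieAlgebra R L] [AddCommGroup M] [Module R M]
  [LieRingModule L M] [LieModule R L M]

instance : Bracket (SplitExt L M) (SplitExt L M) where
  bracket a b := ⟨⁅a.1, b.1⁆, ⁅a.1, b.2⁆ - ⁅b.1, a.2⁆⟩

@[simp] theorem fst_lie (a b : SplitExt L M) : (⁅a, b⁆).1 = ⁅a.1, b.1⁆ := rfl
@[simp] theorem snd_lie (a b : SplitExt L M) : (⁅a, b⁆).2 = ⁅a.1, b.2⁆ - ⁅b.1, a.2⁆ := rfl

instance : LieRing (SplitExt L M) where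
  add_lie a b c := by ext <;> simp; abel
  lie_add a b c := by ext <;> simp; abel
  lie_self a := by ext <;> simp
  leibniz_lie a b c := by ext <;> simp; abel

instance : LieAlgebra R (SplitExt L M) where
  lie_smul r a b := by ext <;> simp [smul_sub]

/-- The projection `L ⋉ M → L`. -/
def fstHom (R L M : Type*) [CommRing R] [LieRing L] [LieAlgebra R L]
    [AddCommGroup M] [Module R M] [LieRingModule L M] [LieModule R L M] :
    SplitExt L M →ₗ⁅R⁆ L where
  toFun a := a.1
  map_add' _ _ := rfl
  map_smul' _ _ := rfl
  map_lie' := rfl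

@[simp] theorem fstHom_apply (a : SplitExt L M) : fstHom R L M a = a.1 := rfl

/-- The inclusion of `L` in `L ⋉ M`. -/
def inl (R L M : Type*) [CommRing R] [LieRing L] [LieAlgebra R L]
    [AddCommGroup M] [Module R M] [LieRingModule L M] [LieModule R L M] :
    L →ₗ⁅R⁆ SplitExt L M where
  toFun a := ⟨a, 0⟩
  map_add' a b := by ext <;> simp
  map_smul' c a := by ext <;> simp
  map_lie' {a b} := by ext <;> simp

@[simp] theorem fst_inl (a : L) : (inl R L M a).1 = a := rfl

/-- The homomorphism `a ↦ (a, a • m)`, which is the inclusion of `L` followed by the inner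
automorphism of `L ⋉ M` defined by `-m`. -/
def conj (R L : Type*) {M : Type*} [CommRing R] [LieRing L] [LieAlgebra R L]
    [AddCommGroup M] [Module R M] [LieRingModule L M] [LieModule R L M] (m : M) :
    L →ₗ⁅R⁆ SplitExt L M where
  toFun a := ⟨a, ⁅a, m⁆⟩
  map_add' a b := by ext <;> simp
  map_smul' c a := by ext <;> simp
  map_lie' {a b} := by ext <;> simp

theorem conj_apply (m : M) (a : L) : conj R L m a = inl R L M a + inr L ⁅a, m⁆ := by
  ext <;> simp [conj, inl]

end SplitExt

/-! ### Free Lie algebras: induction, degrees, derivations -/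

namespace FreeLieAlgebra

variable {P : Type u} [Field P] {X : Type v}

theorem induction {p : FreeLieAlgebra P X → Prop} (zero : p 0) (of : ∀ x, p (of P x))
    (add : ∀ a b, p a → p b → p (a + b)) (smul : ∀ (c : P) a, p a → p (c • a))
    (lie : ∀ a b, p a → p b → p ⁅a, b⁆) (a : FreeLieAlgebra P X) : p a := by
  let S : LieSubalgebra P (FreeLieAlgebra P X) :=
    { carrier := {a | p a}
      add_mem' := fun ha hb => add _ _ ha hb
      zero_mem' := zero
      smul_mem' := fun c _ ha => smul c _ ha
      lie_mem' := fun ha hb => lie _ _ ha hb }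
  let f : FreeLieAlgebra P X →ₗ⁅P⁆ S := lift P fun x => ⟨FreeLieAlgebra.of P x, of x⟩
  have h : S.incl.comp f = LieHom.id := by
    ext x
    simp [f]
  have h' := LieHom.congr_fun h a
  simp only [LieHom.comp_apply, LieHom.id_apply] at h'
  rw [← h']
  exact (f a).2

/-- The homomorphism of free Lie algebras which renames the variables along `f`. -/
noncomputable def map (P : Type u) [Field P] {X : Type v} {Y : Type w} (f : X → Y) :
    FreeLieAlgebra P X →ₗ⁅P⁆ FreeLieAlgebra P Y :=
  lift P fun x => of P (f x)

@[simp] theorem map_of {Y : Type w} (f : X → Y) (x : X) : map P f (of P x) = of P (f x) := by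
  simp [map]

theorem hom_lift {L : Type*} [LieRing L] [LieAlgebra P L] {L' : Type*} [LieRing L'] [LieAlgebra P L']
    (f : L →ₗ⁅P⁆ L') (g : X → L) (a : FreeLieAlgebra P X) :
    f (lift P g a) = lift P (fun x => f (g x)) a := by
  have : f.comp (lift P g) = lift P (fun x => f (g x)) := by ext; simp
  exact LieHom.congr_fun this a

theorem lift_map {Y : Type w} {L : Type*} [LieRing L] [LieAlgebra P L] (f : X → Y) (g : Y → L)
    (a : FreeLieAlgebra P X) : lift P g (map P f a) = lift P (fun x => g (f x)) a := by
  rw [map, hom_lift]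
  simp

/-- `DegLE n a`: the element `a` is a linear combination of bracket monomials of length at most
`n` in the variables. -/
inductive DegLE : ℕ → FreeLieAlgebra P X → Prop
  | zero (n : ℕ) : DegLE n 0
  | of (x : X) : DegLE 1 (of P x)
  | add {n : ℕ} {a b : FreeLieAlgebra P X} : DegLE n a → DegLE n b → DegLE n (a + b)
  | smul {n : ℕ} (c : P) {a : FreeLieAlgebra P X} : DegLE n a → DegLE n (c • a)
  | lie {m n : ℕ} {a b : FreeLieAlgebra P X} : DegLE m a → DegLE n b → DegLE (m + n) ⁅a, b⁆
  | mono {m n : ℕ} {a : FreeLieAlgebra P X} : m ≤ n → DegLE m a → DegLE n a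

theorem DegLE.eq_zero {n : ℕ} {a : FreeLieAlgebra P X} (h : DegLE n a) (hn : n = 0) : a = 0 := by
  induction h with
  | zero => rfl
  | of x => omega
  | add _ _ ha hb => simp [ha hn, hb hn]
  | smul c _ ha => simp [ha hn]
  | lie _ _ ha hb => rw [ha (by omega), zero_lie]
  | mono hmn _ ha => exact ha (by omega)

theorem DegLE.sub {n : ℕ} {a b : FreeLieAlgebra P X} (ha : DegLE n a) (hb : DegLE n b) :
    DegLE n (a - b) := by
  rw [sub_eq_add_neg, ← neg_one_smul P b]
  exact ha.add (hb.smul _)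

theorem exists_degLE (a : FreeLieAlgebra P X) : ∃ n, DegLE n a := by
  induction a using induction with
  | zero => exact ⟨0, .zero 0⟩
  | of x => exact ⟨1, .of x⟩
  | add a b ha hb =>
    obtain ⟨m, hm⟩ := ha
    obtain ⟨n, hn⟩ := hb
    exact ⟨max m n, (hm.mono (le_max_left _ _)).add (hn.mono (le_max_right _ _))⟩
  | smul c a ha => exact ha.imp fun n hn => hn.smul c
  | lie a b ha hb =>
    obtain ⟨m, hm⟩ := ha
    obtain ⟨n, hn⟩ := hb
    exact ⟨m + n, hm.lie hn⟩

/-- A homomorphism which sends the variables to elements of degree at most `1` does not increase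
degrees. -/
theorem DegLE.lift {Y : Type w} {f : X → FreeLieAlgebra P Y} (hf : ∀ x, DegLE 1 (f x)) {n : ℕ}
    {a : FreeLieAlgebra P X} (h : DegLE n a) : DegLE n (lift P f a) := by
  induction h with
  | zero n => simpa using DegLE.zero n
  | of x => simpa using hf x
  | add _ _ ha hb => simpa using ha.add hb
  | smul c _ ha => simpa using ha.smul c
  | lie _ _ ha hb => simpa using ha.lie hb
  | mono h _ ha => exact ha.mono h

/-- The derivation of a free Lie algebra with prescribed values on the variables. -/
noncomputable def derivation (f : X → FreeLieAlgebra P X) :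
    LieDerivation P (FreeLieAlgebra P X) (FreeLieAlgebra P X) where
  toFun a := (lift P (fun x => (⟨of P x, f x⟩ :
    SplitExt (FreeLieAlgebra P X) (FreeLieAlgebra P X))) a).2
  map_add' a b := by simp
  map_smul' c a := by simp
  leibniz' a b := by
    have h (c : FreeLieAlgebra P X) : (lift P (fun x => (⟨of P x, f x⟩ :
        SplitExt (FreeLieAlgebra P X) (FreeLieAlgebra P X))) c).1 = c := by
      have := hom_lift (SplitExt.fstHom P (FreeLieAlgebra P X) (FreeLieAlgebra P X))
        (fun x => (⟨of P x, f x⟩ : SplitExt (FreeLieAlgebra P X) (FreeLieAlgebra P X))) c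
      simp only [SplitExt.fstHom_apply] at this
      rw [this]
      exact LieHom.congr_fun (lift_comp_of LieHom.id) c
    simp [h]

@[simp] theorem derivation_of (f : X → FreeLieAlgebra P X) (x : X) :
    derivation f (of P x) = f x := by
  change SplitExt.snd (lift P _ (of P x)) = _
  rw [lift_of_apply]

theorem of_ne_zero (x : X) : of P x ≠ 0 := by
  intro h
  let _ : LieRing P := LieRing.ofAssociativeRing
  let _ : LieAlgebra P P := LieAlgebra.ofAssociativeAlgebra
  have := congrArg (lift P fun _ : X => (1 : P)) h
  simp at this

end FreeLieAlgebra

/-! ### Elimination of a variable, and the centre of a free Lie algebra -/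

namespace FreeLieAlgebra

open LieAlgebra
open scoped Classical

variable {P : Type u} [Field P] {X : Type v}

theorem DegLE.derivation {f : X → FreeLieAlgebra P X} (hf : ∀ x, DegLE 1 (f x)) {n : ℕ}
    {a : FreeLieAlgebra P X} (h : DegLE n a) : DegLE n (derivation f a) := by
  induction h with
  | zero n => simpa using DegLE.zero n
  | of x => simpa using hf x
  | add _ _ ha hb => simpa using ha.add hb
  | smul c _ ha => simpa using ha.smul c
  | lie ha' hb' ha hb =>
    rw [LieDerivation.apply_lie_eq_sub]
    refine (ha'.lie hb).sub ?_
    rw [add_comm]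
    exact hb'.lie ha
  | mono h _ ha => exact ha.mono h

/-- The endomorphism which sends the variable `x` to `0` and fixes the other variables. -/
noncomputable def setZero (x : X) : FreeLieAlgebra P X →ₗ⁅P⁆ FreeLieAlgebra P X :=
  lift P fun y => if y = x then 0 else of P y

/-- The derivation of the free Lie algebra on the variables `(y, i)`, `i ∈ ℕ`, which sends
`(y, i)` to `(y, i + 1)`. -/
noncomputable def shift (P : Type u) [Field P] (X : Type v) :
    LieDerivation P (FreeLieAlgebra P (X × ℕ)) (FreeLieAlgebra P (X × ℕ)) :=
  derivation fun z => of P (z.1, z.2 + 1)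

/-- Elimination of the variable `x`: the homomorphism from the free Lie algebra on `X` to the
semidirect sum of the free Lie algebra on the variables `(y, i)` with its derivations, which sends
`x` to the shift and any other variable `y` to `(y, 0)`. Thus `(ad x)^i y` goes to `(y, i)`. -/
noncomputable def elim (x : X) : FreeLieAlgebra P X →ₗ⁅P⁆ FreeLieAlgebra P (X × ℕ) ⋊⁅LieHom.id⁆
    LieDerivation P (FreeLieAlgebra P (X × ℕ)) (FreeLieAlgebra P (X × ℕ)) :=
  lift P fun y => if y = x then ⟨0, shift P X⟩ else ⟨of P (y, 0), 0⟩

/-- The homomorphism which sends the variable `(y, i)` to `(ad x)^i y`. -/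
noncomputable def unelim (x : X) : FreeLieAlgebra P (X × ℕ) →ₗ⁅P⁆ FreeLieAlgebra P X :=
  lift P fun z => (fun b => ⁅of P x, b⁆)^[z.2] (of P z.1)

theorem unelim_shift (x : X) (a : FreeLieAlgebra P (X × ℕ)) :
    unelim x (shift P X a) = ⁅of P x, unelim x a⁆ := by
  induction a using induction with
  | zero => simp
  | of z => simp [shift, unelim, Function.iterate_succ_apply']
  | add a b ha hb => simp [ha, hb]
  | smul c a ha => simp [ha]
  | lie a b ha hb =>
    rw [LieDerivation.apply_lie_eq_add, map_add, LieHom.map_lie, LieHom.map_lie, ha, hb,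
      LieHom.map_lie, leibniz_lie (of P x), add_comm]

theorem map_shift {Y : Type w} (f : X → Y) (a : FreeLieAlgebra P (X × ℕ)) :
    map P (Prod.map f id) (shift P X a) = shift P Y (map P (Prod.map f id) a) := by
  induction a using induction with
  | zero => simp
  | of z => simp [shift]
  | add a b ha hb => simp [ha, hb]
  | smul c a ha => simp [ha]
  | lie a b ha hb =>
    rw [LieDerivation.apply_lie_eq_add, map_add, LieHom.map_lie, LieHom.map_lie, ha, hb,
      LieHom.map_lie, LieDerivation.apply_lie_eq_add]

/-- The decomposition `W(X) = P x ⊕ W((X ∖ x) × ℕ)` of the elimination theorem. The degree of the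
component `u` of `a` drops, except on the part of `a` which does not involve `x`; and the
decomposition is compatible with the adjunction of a new variable. -/
theorem exists_elim_eq (x : X) {n : ℕ} {a : FreeLieAlgebra P X} (h : DegLE n a) :
    ∃ (c : P) (u : FreeLieAlgebra P (X × ℕ)),
      DegLE (n - 1) (u - map P (fun y => (y, 0)) (setZero x a)) ∧
      elim x a = ⟨u, c • shift P X⟩ ∧
      elim (some x) (map P some a) = ⟨map P (Prod.map some id) u, c • shift P (Option X)⟩ ∧
      a = c • of P x + unelim x u := by
  have hdeg {n : ℕ} {a : FreeLieAlgebra P X} (h : DegLE n a) :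
      DegLE n (map P (fun y => (y, (0 : ℕ))) (setZero x a)) := by
    refine DegLE.lift (fun y => .of _) (DegLE.lift (fun y => ?_) h)
    split_ifs
    exacts [.zero _, .of _]
  have hzero : ∃ (c : P) (u : FreeLieAlgebra P (X × ℕ)),
      u - map P (fun y => (y, 0)) (setZero x 0) = 0 ∧
      elim x 0 = ⟨u, c • shift P X⟩ ∧
      elim (some x) (map P some 0) = ⟨map P (Prod.map some id) u, c • shift P (Option X)⟩ ∧
      0 = c • of P x + unelim x u :=
    ⟨0, 0, by simp, by simp, by simp, by simp⟩
  induction h with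
  | zero n =>
    obtain ⟨c, u, h1, h2⟩ := hzero
    exact ⟨c, u, h1 ▸ .zero _, h2⟩
  | of y =>
    by_cases hy : y = x
    · subst hy
      exact ⟨1, 0, by simpa [setZero] using .zero _, by simp [elim], by simp [elim], by simp⟩
    · exact ⟨0, of P (y, 0), by simpa [setZero, hy] using .zero _, by simp [elim, hy],
        by simp [elim, hy], by simp [unelim]⟩
  | add _ _ ha hb =>
    obtain ⟨c, u, h1, h2, h3, h4⟩ := ha
    obtain ⟨d, v, k1, k2, k3, k4⟩ := hb
    refine ⟨c + d, u + v, ?_, ?_, ?_, ?_⟩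
    · rw [map_add, map_add, add_sub_add_comm]
      exact h1.add k1
    · rw [map_add, h2, k2, SemiDirectSum.add_eq_mk, add_smul]
    · rw [map_add, map_add, h3, k3, SemiDirectSum.add_eq_mk, add_smul, map_add]
    · conv_lhs => rw [h4, k4]
      rw [map_add, add_smul]
      abel
  | smul r _ ha =>
    obtain ⟨c, u, h1, h2, h3, h4⟩ := ha
    refine ⟨r * c, r • u, ?_, ?_, ?_, ?_⟩
    · rw [map_smul, map_smul, ← smul_sub]
      exact h1.smul r
    · rw [map_smul, h2, SemiDirectSum.smul_eq_mk, mul_smul]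
    · rw [map_smul, map_smul, h3, SemiDirectSum.smul_eq_mk, map_smul, mul_smul]
    · conv_lhs => rw [h4]
      rw [map_smul, smul_add, mul_smul]
  | @lie m n a b ha' hb' ha hb =>
    by_cases hm : m = 0
    · rw [ha'.eq_zero hm, zero_lie]
      obtain ⟨c, u, h1, h2⟩ := hzero
      exact ⟨c, u, h1 ▸ .zero _, h2⟩
    by_cases hn : n = 0
    · rw [hb'.eq_zero hn, lie_zero]
      obtain ⟨c, u, h1, h2⟩ := hzero
      exact ⟨c, u, h1 ▸ .zero _, h2⟩
    obtain ⟨c, u, h1, h2, h3, h4⟩ := ha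
    obtain ⟨d, v, k1, k2, k3, k4⟩ := hb
    have hu := hdeg ha'
    have hv := hdeg hb'
    have hS {w : FreeLieAlgebra P (X × ℕ)} {k : ℕ} (hw : DegLE k w) : DegLE k (shift P X w) :=
      hw.derivation fun z => .of _
    have hu' : DegLE m u := by
      have := (h1.mono (Nat.sub_le m 1)).add hu
      rwa [sub_add_cancel] at this
    have hv' : DegLE n v := by
      have := (k1.mono (Nat.sub_le n 1)).add hv
      rwa [sub_add_cancel] at this
    refine ⟨0, ⁅u, v⁆ + (c • shift P X v - d • shift P X u), ?_, ?_, ?_, ?_⟩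
    · rw [LieHom.map_lie, LieHom.map_lie]
      set u0 := map P (fun y => (y, (0 : ℕ))) (setZero x a)
      set v0 := map P (fun y => (y, (0 : ℕ))) (setZero x b)
      have : ⁅u, v⁆ + (c • shift P X v - d • shift P X u) - ⁅u0, v0⁆ =
          ⁅u - u0, v⁆ + ⁅u0, v - v0⁆ + (c • shift P X v - d • shift P X u) := by
        simp only [sub_lie, lie_sub]
        abel
      rw [this]
      refine ((h1.lie hv').mono (by omega)).add ((hu.lie k1).mono (by omega)) |>.add ?_
      exact (((hS hv').smul c).mono (by omega)).sub (((hS hu').smul d).mono (by omega))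
    · rw [LieHom.map_lie, h2, k2, SemiDirectSum.lie_eq_mk]
      simp [add_sub_assoc]
    · rw [LieHom.map_lie, LieHom.map_lie, h3, k3, SemiDirectSum.lie_eq_mk]
      simp [add_sub_assoc, map_shift]
    · conv_lhs => rw [h4, k4]
      simp only [lie_add, add_lie, lie_smul, smul_lie, lie_self, smul_zero, map_add, map_sub,
        map_smul, LieHom.map_lie, unelim_shift, zero_smul, ← lie_skew (unelim x u) (of P x)]
      module
  | @mono m n a h _ ha =>
    obtain ⟨c, u, h1, h2⟩ := ha
    exact ⟨c, u, h1.mono (by omega), h2⟩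

/-- Every element involves only finitely many variables. -/
theorem exists_finset_support (a : FreeLieAlgebra P X) : ∃ S : Finset X,
    ∀ f : FreeLieAlgebra P X →ₗ⁅P⁆ FreeLieAlgebra P X, (∀ x ∈ S, f (of P x) = 0) → f a = 0 := by
  induction a using induction with
  | zero => exact ⟨∅, fun f _ => map_zero f⟩
  | of x => exact ⟨{x}, fun f hf => hf x (by simp)⟩
  | add a b ha hb =>
    obtain ⟨S, hS⟩ := ha
    obtain ⟨T, hT⟩ := hb
    refine ⟨S ∪ T, fun f hf => ?_⟩
    rw [map_add, hS f fun x hx => hf x (by simp [hx]), hT f fun x hx => hf x (by simp [hx]),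
      add_zero]
  | smul c a ha =>
    obtain ⟨S, hS⟩ := ha
    exact ⟨S, fun f hf => by rw [map_smul, hS f hf, smul_zero]⟩
  | lie a b ha hb =>
    obtain ⟨S, hS⟩ := ha
    exact ⟨S, fun f hf => by rw [LieHom.map_lie, hS f hf, zero_lie]⟩

/-- The element `a` of `W(X)` commutes with a variable outside `X`; in other words all values of
`a` in all Lie algebras are central. -/
def CommutesWithNew (a : FreeLieAlgebra P X) : Prop :=
  ⁅map P some a, of P (none : Option X)⁆ = 0

theorem CommutesWithNew.endo {a : FreeLieAlgebra P X} (h : CommutesWithNew a)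
    (f : FreeLieAlgebra P X →ₗ⁅P⁆ FreeLieAlgebra P X) : CommutesWithNew (f a) := by
  let g : FreeLieAlgebra P (Option X) →ₗ⁅P⁆ FreeLieAlgebra P (Option X) :=
    lift P fun o => o.elim (of P none) fun x => map P some (f (of P x))
  have hg : g.comp (map P some) = (map P some).comp f := by
    ext x
    simp [g]
  have := congrArg g h
  rw [LieHom.map_lie, map_zero] at this
  have h2 := LieHom.congr_fun hg a
  simp only [LieHom.comp_apply] at h2
  rw [h2] at this
  simpa [g, CommutesWithNew] using this

theorem CommutesWithNew.sub {a b : FreeLieAlgebra P X} (ha : CommutesWithNew a)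
    (hb : CommutesWithNew b) : CommutesWithNew (a - b) := by
  unfold CommutesWithNew at *
  rw [map_sub, sub_lie, ha, hb, sub_zero]

theorem eq_zero_of_degLE_of_commutesWithNew (n : ℕ) : ∀ (X : Type v) (a : FreeLieAlgebra P X),
    DegLE n a → CommutesWithNew a → a = 0 := by
  induction n with
  | zero => exact fun X a ha _ => ha.eq_zero rfl
  | succ n ih =>
    intro X a ha hC
    -- the part `b` of `a` which involves `x` vanishes, since elimination of `x` lowers its degree
    have key (x : X) : setZero x a = a := by
      have hb : DegLE (n + 1) (a - setZero x a) := by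
        refine ha.sub (DegLE.lift (fun y => ?_) ha)
        split_ifs
        exacts [.zero _, .of _]
      have hbC : CommutesWithNew (a - setZero x a) := hC.sub (hC.endo _)
      have hb0 : setZero x (a - setZero x a) = 0 := by
        have : (setZero (P := P) x).comp (setZero x) = setZero x := by
          ext y
          by_cases hy : y = x <;> simp [setZero, hy]
        have := LieHom.congr_fun this a
        simp only [LieHom.comp_apply] at this
        rw [map_sub, this, sub_self]
      obtain ⟨c, u, h1, h2, h3, h4⟩ := exists_elim_eq x hb
      rw [hb0, map_zero, sub_zero, Nat.add_sub_cancel] at h1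
      have h5 := congrArg (elim (some x)) hbC
      rw [LieHom.map_lie, h3, map_zero] at h5
      have h6 : elim (some x) (of P (none : Option X)) = ⟨of P (none, 0), 0⟩ := by simp [elim]
      rw [h6, SemiDirectSum.lie_eq_mk] at h5
      have h7 := congrArg SemiDirectSum.left h5
      simp only [LieHom.id_apply, LieDerivation.smul_apply, LieDerivation.zero_apply,
        SemiDirectSum.zero_eq_mk, sub_zero] at h7
      have h8 : shift P (Option X) (of P (none, 0)) = of P (none, 1) := by simp [shift]
      rw [h8] at h7
      -- test homomorphisms which separate the variables `(none, 0)` and `(none, 1)`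
      have h9 (g : X × ℕ → FreeLieAlgebra P (Option (X × ℕ)))
          (p q : FreeLieAlgebra P (Option (X × ℕ))) : ⁅lift P g u, p⁆ + c • q = 0 := by
        have := congrArg (lift P fun z : Option X × ℕ =>
          z.1.elim (if z.2 = 0 then p else q) fun y => g (y, z.2)) h7
        simpa [lift_map] using this
      have hc : c = 0 := by
        have := h9 0 0 (of P none)
        rw [lie_zero, zero_add] at this
        exact (smul_eq_zero.mp this).resolve_right (of_ne_zero _)
      have hu : u = 0 := by
        refine ih _ u h1 ?_
        have := h9 (fun z => of P (some z)) (of P none) 0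
        rwa [smul_zero, add_zero] at this
      rw [hc, hu, zero_smul, map_zero, zero_add, sub_eq_zero] at h4
      exact h4.symm
    obtain ⟨S, hS⟩ := exists_finset_support a
    have hT (T : Finset X) : ∃ f : FreeLieAlgebra P X →ₗ⁅P⁆ FreeLieAlgebra P X,
        (∀ x ∈ T, f (of P x) = 0) ∧ f a = a := by
      induction T using Finset.induction with
      | empty => exact ⟨LieHom.id, by simp, rfl⟩
      | insert x T _ hT =>
        obtain ⟨f, hf, hfa⟩ := hT
        refine ⟨f.comp (setZero x), fun y hy => ?_, by rw [LieHom.comp_apply, key, hfa]⟩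
        by_cases hyx : y = x
        · simp [setZero, hyx]
        · simpa [setZero, hyx] using hf y (Finset.mem_of_mem_insert_of_ne hy hyx)
    obtain ⟨f, hf, hfa⟩ := hT S
    rw [← hfa, hS f hf]

/-- A free Lie algebra `W(X)` acts faithfully on the free Lie algebra with one more variable `t`,
and even on the orbit of `t`. -/
theorem eq_zero_of_lie_new_eq_zero {a : FreeLieAlgebra P X}
    (h : ⁅map P some a, of P (none : Option X)⁆ = 0) : a = 0 := by
  obtain ⟨n, hn⟩ := exists_degLE a
  exact eq_zero_of_degLE_of_commutesWithNew n X a hn h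

end FreeLieAlgebra

/-! ### Binary Lie polynomials which define abelian groups or Lie brackets -/

namespace FreeLieAlgebra

open Polynomial

variable {P : Type u} [Field P]

/-- The value `p(a, b)` of a Lie polynomial `p` in two variables. -/
noncomputable def eval₂ {L : Type v} [LieRing L] [LieAlgebra P L] (p : FreeLieAlgebra P (Fin 2))
    (a b : L) : L :=
  lift P ![a, b] p

theorem map_eval₂ {L : Type v} [LieRing L] [LieAlgebra P L] {L' : Type w} [LieRing L']
    [LieAlgebra P L'] (f : L →ₗ⁅P⁆ L') (p : FreeLieAlgebra P (Fin 2)) (a b : L) :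
    f (eval₂ p a b) = eval₂ p (f a) (f b) := by
  rw [eval₂, hom_lift, eval₂]
  congr 2
  ext i
  fin_cases i <;> rfl

theorem eval₂_of (p : FreeLieAlgebra P (Fin 2)) : eval₂ p (of P 0) (of P 1) = p := by
  have : lift P ![of P (0 : Fin 2), of P 1] = LieHom.id := by
    ext i
    fin_cases i <;> simp
  exact LieHom.congr_fun this p

theorem aeval_toEnd_X_mul {L M : Type*} [LieRing L] [LieAlgebra P L] [AddCommGroup M] [Module P M]
    [LieRingModule L M] [LieModule P L M] (b : L) (q : P[X]) (m : M) :
    aeval (LieModule.toEnd P L M b) (X * q) m = ⁅b, aeval (LieModule.toEnd P L M b) q m⁆ := by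
  simp

/-- In a split extension `L ⋉ M`, Lie polynomials are affine along `M`, and the operators on `M`
which occur in the values at multiples of a single element `b` are polynomials in `ad b`. -/
theorem exists_eval₂_splitExt (p : FreeLieAlgebra P (Fin 2)) (α β : P) :
    ∃ (c : P) (q : P[X]), ∀ (L M : Type u) [LieRing L] [LieAlgebra P L] [AddCommGroup M]
      [Module P M] [LieRingModule L M] [LieModule P L M] (b : SplitExt L M) (m : M),
      eval₂ p (α • b) (β • b + SplitExt.inr L m) =
        c • b + SplitExt.inr L (aeval (LieModule.toEnd P L M b.fst) q m) := by
  induction p using induction with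
  | zero =>
    refine ⟨0, 0, fun L M _ _ _ _ _ _ b m => ?_⟩
    ext <;> simp [eval₂]
  | of i =>
    fin_cases i
    · refine ⟨α, 0, fun L M _ _ _ _ _ _ b m => ?_⟩
      ext <;> simp [eval₂]
    · refine ⟨β, 1, fun L M _ _ _ _ _ _ b m => ?_⟩
      ext <;> simp [eval₂]
  | add p₁ p₂ h₁ h₂ =>
    obtain ⟨c₁, q₁, h₁⟩ := h₁
    obtain ⟨c₂, q₂, h₂⟩ := h₂
    refine ⟨c₁ + c₂, q₁ + q₂, fun L M _ _ _ _ _ _ b m => ?_⟩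
    have e₁ := h₁ L M b m
    have e₂ := h₂ L M b m
    unfold eval₂ at *
    rw [map_add, e₁, e₂]
    ext
    · simp [add_smul]
    · simp only [SplitExt.snd_add, SplitExt.snd_smul, SplitExt.snd_inr, map_add,
        LinearMap.add_apply, add_smul]
      abel
  | smul r p h =>
    obtain ⟨c, q, h⟩ := h
    refine ⟨r * c, r • q, fun L M _ _ _ _ _ _ b m => ?_⟩
    have e := h L M b m
    unfold eval₂ at *
    rw [map_smul, e]
    ext <;> simp [mul_smul]
  | lie p₁ p₂ h₁ h₂ =>
    obtain ⟨c₁, q₁, h₁⟩ := h₁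
    obtain ⟨c₂, q₂, h₂⟩ := h₂
    refine ⟨0, X * (c₁ • q₂ - c₂ • q₁), fun L M _ _ _ _ _ _ b m => ?_⟩
    have e₁ := h₁ L M b m
    have e₂ := h₂ L M b m
    unfold eval₂ at *
    rw [LieHom.map_lie, e₁, e₂, aeval_toEnd_X_mul]
    ext
    · simp
    · simp 
      abel

section

attribute [local instance] LieRing.ofAssociativeRing

theorem aeval_toEnd_mulLeft (c : P) (q f : P[X]) :
    aeval (LieModule.toEnd P (Module.End P P[X]) P[X] (c • LinearMap.mulLeft P X)) q f =
      q.comp (C c * X) * f := by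
  rw [LieModule.toEnd_module_end, LieHom.id_apply]
  induction q using Polynomial.induction_on with
  | C a => simp [Algebra.algebraMap_eq_smul_one, smul_eq_C_mul]
  | add p q hp hq => simp [hp, hq, add_mul]
  | monomial n r h =>
    have : C r * X ^ (n + 1) = X * (C r * X ^ n) := by ring
    rw [this, map_mul, Module.End.mul_apply, h]
    simp [smul_eq_C_mul, mul_assoc]

/-- The free Lie algebra with one more variable, as a module over the free Lie algebra. -/
def NewVar (P : Type u) [Field P] (X : Type v) := FreeLieAlgebra P (Option X)

noncomputable instance (X : Type v) : AddCommGroup (NewVar P X) :=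
  inferInstanceAs (AddCommGroup (FreeLieAlgebra P (Option X)))

noncomputable instance (X : Type v) : Module P (NewVar P X) :=
  inferInstanceAs (Module P (FreeLieAlgebra P (Option X)))

noncomputable instance (X : Type v) : LieRingModule (FreeLieAlgebra P X) (NewVar P X) :=
  LieRingModule.compLieHom (FreeLieAlgebra P (Option X)) (map P some)

instance (X : Type v) : LieModule P (FreeLieAlgebra P X) (NewVar P X) :=
  LieModule.compLieHom (FreeLieAlgebra P (Option X)) (map P some)

/-- If a Lie polynomial `p(x, y)` has the formal properties of an abelian group law, with the inverse
of `a` a multiple of `a`, then `p(x, y) = x + y`. -/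
theorem eq_add_of_group_law (p : FreeLieAlgebra P (Fin 2))
    (hassoc : ∀ (L : Type u) [LieRing L] [LieAlgebra P L] (a b c : L),
      eval₂ p (eval₂ p a b) c = eval₂ p a (eval₂ p b c))
    (hcomm : ∀ (L : Type u) [LieRing L] [LieAlgebra P L] (a b : L), eval₂ p a b = eval₂ p b a)
    (hzero : ∀ (L : Type u) [LieRing L] [LieAlgebra P L] (a : L), eval₂ p a 0 = a)
    {c : P} (hc : c ≠ 0)
    (hneg : ∀ (L : Type u) [LieRing L] [LieAlgebra P L] (a : L), eval₂ p a (c • a) = 0) :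
    p = of P 0 + of P 1 := by
  obtain ⟨c₁, q, hq'⟩ := exists_eval₂_splitExt p 1 0
  have hq (L M : Type u) [LieRing L] [LieAlgebra P L] [AddCommGroup M]
      [Module P M] [LieRingModule L M] [LieModule P L M] (b : SplitExt L M) (m : M) :
      eval₂ p b (SplitExt.inr L m) =
        b + SplitExt.inr L (aeval (LieModule.toEnd P L M b.fst) q m) := by
    have h₀ := hq' L M b 0
    have h₁ := hq' L M b m
    have hi : SplitExt.inr L (0 : M) = 0 := rfl
    rw [one_smul, zero_smul, zero_add, map_zero, hi, hzero, add_zero] at h₀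
    rwa [one_smul, zero_smul, zero_add, ← h₀] at h₁
  -- the operator `q(ad b)` is invertible, hence `q = 1`
  have hq1 : q = 1 := by
    obtain ⟨d, r, hr⟩ := exists_eval₂_splitExt p 1 c
    let b : SplitExt (Module.End P P[X]) P[X] := ⟨LinearMap.mulLeft P X, 0⟩
    have h₀ : eval₂ p 0 (SplitExt.inr _ 1) = (SplitExt.inr _ 1 : SplitExt (Module.End P P[X]) P[X]) := by
      rw [hcomm, hzero]
    have h₁ := hassoc _ b (c • b) (SplitExt.inr _ 1)
    rw [hneg, h₀, hq] at h₁
    have h₂ := hr _ _ b (aeval (LieModule.toEnd P (Module.End P P[X]) P[X] (c • b).fst) q 1)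
    rw [one_smul, ← h₁] at h₂
    have h₃ := congrArg SplitExt.snd h₂
    have h₄ := aeval_toEnd_mulLeft c q 1
    have h₅ := aeval_toEnd_mulLeft 1 r (q.comp (C c * X))
    rw [one_smul] at h₅
    simp only [SplitExt.snd_inr, SplitExt.snd_add, SplitExt.snd_smul, SplitExt.fst_smul, b,
      smul_zero, zero_add, h₄, mul_one, h₅] at h₃
    have h₆ : IsUnit (q.comp (C c * X)) := IsUnit.of_mul_eq_one_right _ h₃.symm
    have h₇ := natDegree_eq_zero_of_isUnit h₆
    rw [natDegree_comp, natDegree_C_mul_X _ hc, mul_one] at h₇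
    obtain ⟨r, rfl⟩ := natDegree_eq_zero.mp h₇
    have h₈ := hq _ _ (0 : SplitExt (Module.End P P[X]) P[X]) 1
    rw [h₀] at h₈
    have h₉ := congrArg SplitExt.snd h₈
    simp [Algebra.algebraMap_eq_smul_one, smul_eq_C_mul] at h₉
    exact h₉.symm
  subst hq1
  have hinr (L M : Type u) [LieRing L] [LieAlgebra P L] [AddCommGroup M]
      [Module P M] [LieRingModule L M] [LieModule P L M] (a b : SplitExt L M) (m : M) :
      eval₂ p a (b + SplitExt.inr L m) = eval₂ p a b + SplitExt.inr L m := by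
    have h := hassoc _ a b (SplitExt.inr L m)
    rw [hq, hq] at h
    simpa using h.symm
  -- the substitution `x ↦ x + ⁅x, t⁆`, `y ↦ y + ⁅y, t⁆` is conjugation, so it sends `p` to
  -- `p + ⁅p, t⁆`; on the other hand it is computed by the affinity of `p` along the module
  let t : NewVar P (Fin 2) := of P none
  have ht := SplitExt.conj_apply (R := P) (L := FreeLieAlgebra P (Fin 2)) t
  have h := map_eval₂ (SplitExt.conj P _ t) p (of P (0 : Fin 2)) (of P 1)
  rw [eval₂_of, ht (of P 0), ht (of P 1), hinr, hcomm, hinr, hcomm, ← map_eval₂, eval₂_of, ht,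
    add_assoc, add_right_inj] at h
  have h' := congrArg SplitExt.snd h
  simp only [SplitExt.snd_add, SplitExt.snd_inr] at h'
  rw [← sub_eq_zero]
  refine eq_zero_of_lie_new_eq_zero ?_
  change ⁅p - (of P (0 : Fin 2) + of P 1), t⁆ = 0
  rw [sub_lie, h', add_lie, add_comm, sub_self]

/-- A Lie polynomial `p(x, y)` which is additive in `x` and alternating is a multiple
of `⁅x, y⁆`. -/
theorem eq_smul_lie_of_additive (p : FreeLieAlgebra P (Fin 2))
    (hadd : ∀ (L : Type u) [LieRing L] [LieAlgebra P L] (a b c : L),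
      eval₂ p (a + b) c = eval₂ p a c + eval₂ p b c)
    (hskew : ∀ (L : Type u) [LieRing L] [LieAlgebra P L] (a b : L),
      eval₂ p a b = - eval₂ p b a) :
    ∃ κ : P, p = κ • ⁅of P (0 : Fin 2), of P 1⁆ := by
  have hadd' (L : Type u) [LieRing L] [LieAlgebra P L] (a b c : L) :
      eval₂ p a (b + c) = eval₂ p a b + eval₂ p a c := by
    rw [hskew, hadd, hskew _ a b, hskew _ a c, neg_add]
  have hzero (L : Type u) [LieRing L] [LieAlgebra P L] (a : L) : eval₂ p a 0 = 0 := by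
    simpa using hadd' L a 0 0
  obtain ⟨c₁, q, hq'⟩ := exists_eval₂_splitExt p 1 0
  have hq (L M : Type u) [LieRing L] [LieAlgebra P L] [AddCommGroup M]
      [Module P M] [LieRingModule L M] [LieModule P L M] (b : SplitExt L M) (m : M) :
      eval₂ p b (SplitExt.inr L m) =
        SplitExt.inr L (aeval (LieModule.toEnd P L M b.fst) q m) := by
    have h₀ := hq' L M b 0
    have h₁ := hq' L M b m
    have hi : SplitExt.inr L (0 : M) = 0 := rfl
    rw [one_smul, zero_smul, zero_add, map_zero, hi, hzero, add_zero] at h₀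
    rwa [one_smul, zero_smul, zero_add, ← h₀, zero_add] at h₁
  -- `q(A + B) = q(A) + q(B)` for all operators `A`, `B`; test operators show that `q` is linear
  obtain ⟨κ, rfl⟩ : ∃ κ : P, q = C κ * X := by
    let A : Module.End P (P[X] × P[X]) := LinearMap.inl P _ _ ∘ₗ LinearMap.snd P _ _
    let B : Module.End P (P[X] × P[X]) :=
      LinearMap.inr P _ _ ∘ₗ LinearMap.mulLeft P X ∘ₗ LinearMap.snd P _ _
    have hsum : aeval (A + B) q (0, 1) = aeval A q (0, 1) + aeval B q (0, 1) := by
      have h := hadd (SplitExt (Module.End P (P[X] × P[X])) (P[X] × P[X])) ⟨A, 0⟩ ⟨B, 0⟩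
        (SplitExt.inr _ (0, 1))
      rw [hq, hq, hq] at h
      have := congrArg SplitExt.snd h
      simpa only [LieModule.toEnd_module_end, SplitExt.snd_add, SplitExt.snd_inr,
        SplitExt.fst_add, LieHom.id_apply] using this
    have hAB (r : P[X]) : aeval (A + B) r (0, 1) = (divX r, r) := by
      induction r using Polynomial.induction_on with
      | C a => simp [Algebra.algebraMap_eq_smul_one, smul_eq_C_mul]
      | add r s hr hs => simp [hr, hs, divX_add]
      | monomial n a h =>
        have : C a * X ^ (n + 1) = X * (C a * X ^ n) := by ring
        rw [this, map_mul, Module.End.mul_apply, h]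
        have : (X * (C a * X ^ n)).divX = C a * X ^ n := by
          ext k
          rw [coeff_divX, coeff_X_mul]
        rw [this]
        simp [A, B]
    have hA (r : P[X]) : aeval A r (0, 1) = (C (r.coeff 1), C (r.coeff 0)) := by
      induction r using Polynomial.induction_on with
      | C a => simp [Algebra.algebraMap_eq_smul_one, smul_eq_C_mul]
      | add r s hr hs => simp [hr, hs]
      | monomial n a h =>
        have : C a * X ^ (n + 1) = X * (C a * X ^ n) := by ring
        rw [this, map_mul, Module.End.mul_apply, h]
        simp [A]
    have hB (r : P[X]) : aeval B r (0, 1) = (0, r) := by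
      induction r using Polynomial.induction_on with
      | C a => simp [Algebra.algebraMap_eq_smul_one, smul_eq_C_mul]
      | add r s hr hs => simp [hr, hs]
      | monomial n a h =>
        have : C a * X ^ (n + 1) = X * (C a * X ^ n) := by ring
        rw [this, map_mul, Module.End.mul_apply, h]
        simp [B]
    rw [hAB, hA, hB, Prod.mk_add_mk, add_zero, Prod.mk.injEq] at hsum
    obtain ⟨h₁, h₂⟩ := hsum
    refine ⟨q.coeff 1, ?_⟩
    have h₃ := divX_mul_X_add q
    have h₄ : C (q.coeff 0) = 0 := by simpa using h₂
    rw [h₁, h₄, add_zero] at h₃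
    exact h₃.symm
  refine ⟨κ, ?_⟩
  -- conjugation sends `p` to `p + ⁅p, t⁆`; biadditivity expresses the same element by `κ`
  let t : NewVar P (Fin 2) := of P none
  have ht := SplitExt.conj_apply (R := P) (L := FreeLieAlgebra P (Fin 2)) t
  have h := map_eval₂ (SplitExt.conj P _ t) p (of P (0 : Fin 2)) (of P 1)
  rw [eval₂_of, ht (of P 0), ht (of P 1), hadd, hadd', hadd', ← map_eval₂, eval₂_of, ht,
    add_assoc, add_right_inj, hq, hq, hskew _ _ (SplitExt.inl _ _ _ _), hq] at h
  have h' := congrArg SplitExt.snd h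
  rw [← sub_eq_zero]
  refine eq_zero_of_lie_new_eq_zero ?_
  change ⁅p - κ • ⁅of P (0 : Fin 2), of P 1⁆, t⁆ = 0
  simp only [SplitExt.snd_inr, SplitExt.snd_add, SplitExt.snd_neg, SplitExt.fst_inl,
    SplitExt.fst_inr, ← smul_eq_C_mul, map_smul, aeval_X, LinearMap.smul_apply,
    LieModule.toEnd_apply_apply, zero_lie, smul_zero, add_zero] at h'
  rw [sub_lie, h', smul_lie, lie_lie, smul_sub]
  abel

end

end FreeLieAlgebra

/-! ### Bijections of free Lie algebras compatible with substitution -/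

namespace FreeLieAlgebra

variable {P : Type u} [Field P] {𝒰 : Type a}

theorem exists_eq_smul_of {X : Type v} [Unique X] (b : FreeLieAlgebra P X) :
    ∃ c : P, b = c • of P default := by
  induction b using induction with
  | zero => exact ⟨0, by simp⟩
  | of x => exact ⟨1, by rw [one_smul, Unique.eq_default x]⟩
  | add b₁ b₂ h₁ h₂ =>
    obtain ⟨c₁, rfl⟩ := h₁
    obtain ⟨c₂, rfl⟩ := h₂
    exact ⟨c₁ + c₂, by rw [add_smul]⟩
  | smul r b h =>
    obtain ⟨c, rfl⟩ := h
    exact ⟨r * c, by rw [mul_smul]⟩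
  | lie b₁ b₂ h₁ h₂ =>
    obtain ⟨c₁, rfl⟩ := h₁
    obtain ⟨c₂, rfl⟩ := h₂
    exact ⟨0, by simp⟩

/-- A family of bijections `s_X : W(X) → W(X)` which fix the variables and are compatible with
substitutions. Conjugation by such a family is an automorphism of the category of the algebras
`W(X)`, which takes a homomorphism `f` to the homomorphism with the values `s (f y)` at the
variables `y`. -/
structure IsSubstitutive (s : ∀ X : Finset 𝒰, FreeLieAlgebra P X → FreeLieAlgebra P X) : Prop where
  bijective : ∀ X, Function.Bijective (s X)
  map_of : ∀ (X : Finset 𝒰) (x : X), s X (of P x) = of P x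
  map_hom : ∀ (X Y : Finset 𝒰) (f : FreeLieAlgebra P Y →ₗ⁅P⁆ FreeLieAlgebra P X)
    (p : FreeLieAlgebra P Y), s X (f p) = lift P (fun y => s X (f (of P y))) (s Y p)

namespace IsSubstitutive

variable [Infinite 𝒰] {s : ∀ X : Finset 𝒰, FreeLieAlgebra P X → FreeLieAlgebra P X}

/-- The operations of a Lie algebra are transformed by `s` into derived operations. -/
theorem exists_map_lift (hs : IsSubstitutive s) {k : ℕ} (p : FreeLieAlgebra P (Fin k)) :
    ∃ q : FreeLieAlgebra P (Fin k), ∀ (X : Finset 𝒰) (b : Fin k → FreeLieAlgebra P X),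
      s X (lift P b p) = lift P (fun i => s X (b i)) q := by
  obtain ⟨Y, hY⟩ := Infinite.exists_subset_card_eq 𝒰 k
  let e := Y.equivFinOfCardEq hY
  refine ⟨map P e (s Y (map P e.symm p)), fun X b => ?_⟩
  have h := hs.map_hom X Y (lift P fun y => b (e y)) (map P e.symm p)
  rw [lift_map] at h
  simpa [lift_map] using h

theorem exists_map_smul (hs : IsSubstitutive s) (c : P) :
    ∃ d : P, ∀ (X : Finset 𝒰) (b : FreeLieAlgebra P X), s X (c • b) = d • s X b := by
  obtain ⟨q, hq⟩ := hs.exists_map_lift (c • of P (0 : Fin 1))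
  obtain ⟨d, rfl⟩ := exists_eq_smul_of q
  refine ⟨d, fun X b => ?_⟩
  simpa using hq X fun _ => b

theorem exists_map_eval₂ (hs : IsSubstitutive s) (p : FreeLieAlgebra P (Fin 2)) :
    ∃ q : FreeLieAlgebra P (Fin 2), ∀ (X : Finset 𝒰) (b c : FreeLieAlgebra P X),
      s X (eval₂ p b c) = eval₂ q (s X b) (s X c) := by
  obtain ⟨q, hq⟩ := hs.exists_map_lift p
  refine ⟨q, fun X b c => ?_⟩
  rw [eval₂, hq, eval₂]
  congr 2
  ext i
  fin_cases i <;> rfl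

/-- Any three elements of a Lie algebra are the images under a homomorphism of three values
of `s`. -/
theorem exists_hom_eq (hs : IsSubstitutive s) {L : Type*} [LieRing L] [LieAlgebra P L]
    (b c d : L) : ∃ (X : Finset 𝒰) (f : FreeLieAlgebra P X →ₗ⁅P⁆ L) (b' c' d' : FreeLieAlgebra P X),
      f (s X b') = b ∧ f (s X c') = c ∧ f (s X d') = d := by
  obtain ⟨X, hX⟩ := Infinite.exists_subset_card_eq 𝒰 3
  let e := X.equivFinOfCardEq hX
  refine ⟨X, lift P fun x => ![b, c, d] (e x), of P (e.symm 0), of P (e.symm 1), of P (e.symm 2),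
    ?_, ?_, ?_⟩ <;> simp [hs.map_of]

protected theorem map_zero (hs : IsSubstitutive s) (X : Finset 𝒰) : s X 0 = 0 := by
  obtain ⟨d, hd⟩ := hs.exists_map_smul 0
  obtain ⟨b, hb⟩ := (hs.bijective X).2 0
  have := hd X b
  rwa [zero_smul, hb, smul_zero] at this

protected theorem map_add (hs : IsSubstitutive s) (X : Finset 𝒰) (b c : FreeLieAlgebra P X) :
    s X (b + c) = s X b + s X c := by
  obtain ⟨q, hq⟩ := hs.exists_map_eval₂ (of P 0 + of P 1)
  have hq' (X : Finset 𝒰) (b c : FreeLieAlgebra P X) : eval₂ q (s X b) (s X c) = s X (b + c) := by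
    rw [← hq]
    simp [eval₂]
  obtain ⟨ν, hν⟩ := hs.exists_map_smul (-1)
  have hν0 : ν ≠ 0 := by
    rintro rfl
    obtain ⟨x⟩ := (inferInstance : Nonempty 𝒰)
    have h := hν {x} (of P ⟨x, Finset.mem_singleton_self x⟩)
    rw [zero_smul, ← hs.map_zero] at h
    have h' := (hs.bijective _).1 h
    rw [smul_eq_zero] at h'
    exact h'.elim (neg_ne_zero.mpr one_ne_zero) (of_ne_zero _)
  have : q = of P 0 + of P 1 := by
    refine eq_add_of_group_law q (fun L _ _ b c d => ?_) (fun L _ _ b c => ?_) (fun L _ _ b => ?_)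
      hν0 (fun L _ _ b => ?_)
    · obtain ⟨X, f, b, c, d, rfl, rfl, rfl⟩ := hs.exists_hom_eq b c d
      simp only [← map_eval₂, hq', add_assoc]
    · obtain ⟨X, f, b, c, -, rfl, rfl, -⟩ := hs.exists_hom_eq b c c
      simp only [← map_eval₂, hq', add_comm]
    · obtain ⟨X, f, b, -, -, rfl, -⟩ := hs.exists_hom_eq b b b
      rw [← map_zero f, ← map_eval₂, ← hs.map_zero, hq', add_zero]
    · obtain ⟨X, f, b, -, -, rfl, -⟩ := hs.exists_hom_eq b b b
      rw [← map_smul, ← hν, ← map_eval₂, hq', neg_one_smul, add_neg_cancel, hs.map_zero,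
        map_zero]
  rw [← hq', this]
  simp [eval₂]

protected theorem map_neg (hs : IsSubstitutive s) (X : Finset 𝒰) (b : FreeLieAlgebra P X) :
    s X (-b) = - s X b := by
  rw [eq_neg_iff_add_eq_zero, ← hs.map_add, neg_add_cancel, hs.map_zero]

theorem exists_map_lie (hs : IsSubstitutive s) : ∃ κ : P, κ ≠ 0 ∧
    ∀ (X : Finset 𝒰) (b c : FreeLieAlgebra P X), s X ⁅b, c⁆ = κ • ⁅s X b, s X c⁆ := by
  obtain ⟨q, hq⟩ := hs.exists_map_eval₂ ⁅of P (0 : Fin 2), of P 1⁆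
  have hq' (X : Finset 𝒰) (b c : FreeLieAlgebra P X) : eval₂ q (s X b) (s X c) = s X ⁅b, c⁆ := by
    rw [← hq]
    simp [eval₂]
  obtain ⟨κ, hκ⟩ : ∃ κ : P, q = κ • ⁅of P (0 : Fin 2), of P 1⁆ := by
    refine eq_smul_lie_of_additive q (fun L _ _ b c d => ?_) (fun L _ _ b c => ?_)
    · obtain ⟨X, f, b, c, d, rfl, rfl, rfl⟩ := hs.exists_hom_eq b c d
      simp only [← map_add, ← map_eval₂, ← hs.map_add, hq', add_lie]
    · obtain ⟨X, f, b, c, -, rfl, rfl, -⟩ := hs.exists_hom_eq b c c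
      rw [← map_eval₂, ← map_eval₂, hq', hq', ← map_neg, ← hs.map_neg, lie_skew]
  have hlie (X : Finset 𝒰) (b c : FreeLieAlgebra P X) : s X ⁅b, c⁆ = κ • ⁅s X b, s X c⁆ := by
    rw [← hq', hκ]
    simp [eval₂]
  refine ⟨κ, ?_, hlie⟩
  rintro rfl
  -- otherwise all brackets in `W(x, y)` vanish, while `y` does not commute with `x`
  obtain ⟨X, hX⟩ := Infinite.exists_subset_card_eq 𝒰 2
  let e := X.equivFinOfCardEq hX
  have h := hlie X (of P (e.symm 0)) (of P (e.symm 1))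
  rw [zero_smul, ← hs.map_zero] at h
  have h' := congrArg (lift P fun x : X => if e x = 0 then of P (some ()) else of P none)
    ((hs.bijective _).1 h)
  have : of P () = 0 := eq_zero_of_lie_new_eq_zero (by simpa using h')
  exact of_ne_zero _ this

/-- Substitutive bijections are semilinear, and multiply the Lie bracket by a constant. -/
theorem exists_semilinear (hs : IsSubstitutive s) :
    ∃ (σ : P ≃+* P) (κ : P), κ ≠ 0 ∧ ∀ X : Finset 𝒰,
      (∀ b c, s X (b + c) = s X b + s X c) ∧ (∀ (r : P) b, s X (r • b) = σ r • s X b) ∧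
      (∀ b c, s X ⁅b, c⁆ = κ • ⁅s X b, s X c⁆) := by
  obtain ⟨κ, hκ, hlie⟩ := hs.exists_map_lie
  choose σ hσ using hs.exists_map_smul
  obtain ⟨x⟩ := (inferInstance : Nonempty 𝒰)
  let X : Finset 𝒰 := {x}
  let x' : X := ⟨x, Finset.mem_singleton_self x⟩
  let t : FreeLieAlgebra P X := of P x'
  have ht : t ≠ 0 := of_ne_zero _
  have hst : s X t = t := hs.map_of _ _
  have hσt (c : P) : s X (c • t) = σ c • t := by rw [hσ, hst]
  have hσmul (c d : P) : σ (c * d) = σ c * σ d :=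
    smul_left_injective P ht (by simp only [← hσt, mul_smul]; rw [hσ, hσt])
  have hσadd (c d : P) : σ (c + d) = σ c + σ d :=
    smul_left_injective P ht (by simp only [← hσt, add_smul]; rw [hs.map_add])
  have hσbij : Function.Bijective σ := by
    refine ⟨fun c d h => smul_left_injective P ht ((hs.bijective X).1 ?_), fun d => ?_⟩
    · simp only [hσt, h]
    · obtain ⟨b, hb⟩ := (hs.bijective X).2 (d • t)
      let _ : Unique X := ⟨⟨x'⟩, fun y => Subtype.ext (Finset.mem_singleton.mp y.2)⟩
      obtain ⟨c, rfl⟩ := exists_eq_smul_of b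
      refine ⟨c, smul_left_injective P ht ?_⟩
      simp only [← hσt]
      exact hb
  exact ⟨RingEquiv.mk (Equiv.ofBijective σ hσbij) hσmul hσadd, κ, hκ, fun X =>
    ⟨hs.map_add X, fun r b => hσ r X b, hlie X⟩⟩

end IsSubstitutive

end FreeLieAlgebra

/-! ### Morphisms of algebraic sets -/

namespace AlgSetCat

variable {P : Type u} [Field P] {𝒰 : Type a} {H : Type v} [LieRing H] [LieAlgebra P H]

theorem hom_ext {V V' : AlgSetCat P 𝒰 H} {f g : V ⟶ V'}
    (h : ∀ (ν : V.pts) (y : V'.vars), (f.1 ν).1 (FreeLieAlgebra.of P y) =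
      (g.1 ν).1 (FreeLieAlgebra.of P y)) : f = g :=
  Subtype.ext (funext fun ν => Subtype.ext (FreeLieAlgebra.hom_ext (h ν)))

/-- The morphism `ν ↦ ν ∘ t` of algebraic sets. -/
noncomputable def ofHom {V V' : AlgSetCat P 𝒰 H} (t : FreeLieAlgebra P V'.vars →ₗ⁅P⁆ FreeLieAlgebra P V.vars)
    (h : ∀ ν ∈ V.pts, ν.comp t ∈ V'.pts) : V ⟶ V' :=
  ⟨fun ν => ⟨ν.1.comp t, h ν.1 ν.2⟩, t, fun _ => rfl⟩

@[simp] theorem ofHom_apply {V V' : AlgSetCat P 𝒰 H}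
    (t : FreeLieAlgebra P V'.vars →ₗ⁅P⁆ FreeLieAlgebra P V.vars)
    (h : ∀ ν ∈ V.pts, ν.comp t ∈ V'.pts) (ν : V.pts) (p : FreeLieAlgebra P V'.vars) :
    ((ofHom t h).1 ν).1 p = ν.1 (t p) := rfl

theorem exists_eq_ofHom {V V' : AlgSetCat P 𝒰 H} (f : V ⟶ V') : ∃ t h, f = ofHom t h := by
  obtain ⟨t, ht⟩ := f.2
  exact ⟨t, fun ν hν => ht ⟨ν, hν⟩ ▸ (f.1 ⟨ν, hν⟩).2,
    Subtype.ext (funext fun ν => Subtype.ext (ht ν))⟩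

@[simp] theorem comp_apply {V V' V'' : AlgSetCat P 𝒰 H} (f : V ⟶ V') (g : V' ⟶ V'') (ν : V.pts) :
    (f ≫ g).1 ν = g.1 (f.1 ν) := rfl

theorem zero_mem (V : AlgSetCat P 𝒰 H) : (0 : FreeLieAlgebra P V.vars →ₗ⁅P⁆ H) ∈ V.pts := by
  obtain ⟨T, hT⟩ := V.isAlgebraic
  rw [hT]
  exact fun _ _ => rfl

/-- The zero morphisms are the constant maps to the zero point `0 : W(X) → H`. -/
noncomputable instance : Limits.HasZeroMorphisms (AlgSetCat P 𝒰 H) where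
  zero V V' := ⟨ofHom 0 fun ν _ => by
    convert V'.zero_mem
    ext
    simp⟩
  comp_zero f V := hom_ext fun ν y => by
    change (f.1 ν).1 0 = ν.1 0
    simp
  zero_comp V V' V'' f := hom_ext fun ν y => by
    obtain ⟨t, h, rfl⟩ := exists_eq_ofHom f
    change ν.1 0 = ν.1 0
    rfl

@[simp] theorem zero_apply (V V' : AlgSetCat P 𝒰 H) (ν : V.pts) (p : FreeLieAlgebra P V'.vars) :
    ((0 : V ⟶ V').1 ν).1 p = 0 :=
  map_zero ν.1

/-- The affine space `Hom(W(X), H)`. -/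
abbrev aff (H : Type v) [LieRing H] [LieAlgebra P H] (X : Finset 𝒰) : AlgSetCat P 𝒰 H :=
  ⟨X, Set.univ, isAlgebraicSet_univ⟩

/-- The function `ν ↦ ν p` on an algebraic set defined by a Lie polynomial `p`, as a morphism to
the affine line, that is, to the affine space of a single variable `x`. -/
noncomputable def coord (x : 𝒰) {V : AlgSetCat P 𝒰 H} (p : FreeLieAlgebra P V.vars) :
    V ⟶ aff H {x} :=
  ofHom (V' := aff H {x}) (FreeLieAlgebra.lift P fun _ => p) fun _ _ => Set.mem_univ _

variable {x : 𝒰}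

theorem coord_apply_of {V : AlgSetCat P 𝒰 H} (p : FreeLieAlgebra P V.vars) (ν : V.pts)
    (y : (aff (P := P) H {x}).vars) :
    ((coord x p).1 ν).1 (FreeLieAlgebra.of P y) = ν.1 p := by
  rw [coord, ofHom_apply, FreeLieAlgebra.lift_of_apply]

theorem coord_eq_coord_iff {V : AlgSetCat P 𝒰 H} {p q : FreeLieAlgebra P V.vars} :
    coord x p = coord x q ↔ ∀ ν ∈ V.pts, ν p = ν q := by
  constructor
  · intro h ν hν
    rw [← coord_apply_of (x := x) p ⟨ν, hν⟩ ⟨x, Finset.mem_singleton_self x⟩, h, coord_apply_of]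
  · intro h
    refine hom_ext fun ν y => ?_
    rw [coord_apply_of, coord_apply_of, h ν.1 ν.2]

theorem exists_eq_coord {V : AlgSetCat P 𝒰 H} (f : V ⟶ aff H {x}) :
    ∃ p : FreeLieAlgebra P V.vars, f = coord x p := by
  obtain ⟨t, h, rfl⟩ := exists_eq_ofHom f
  refine ⟨t (FreeLieAlgebra.of P ⟨x, Finset.mem_singleton_self x⟩), hom_ext fun ν y => ?_⟩
  rw [coord_apply_of, ofHom_apply]
  congr 3
  exact Subtype.ext (Finset.mem_singleton.mp y.2)

theorem ofHom_comp_coord {V V' : AlgSetCat P 𝒰 H}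
    (t : FreeLieAlgebra P V'.vars →ₗ⁅P⁆ FreeLieAlgebra P V.vars)
    (h : ∀ ν ∈ V.pts, ν.comp t ∈ V'.pts) (p : FreeLieAlgebra P V'.vars) :
    ofHom t h ≫ coord x p = coord x (t p) :=
  hom_ext fun ν y => by rw [comp_apply, coord_apply_of, coord_apply_of, ofHom_apply]

theorem comp_coord_apply_of {V V' : AlgSetCat P 𝒰 H} (f : V ⟶ V') (p : FreeLieAlgebra P V'.vars)
    (ν : V.pts) (y : (aff (P := P) H {x}).vars) :
    ((f ≫ coord x p).1 ν).1 (FreeLieAlgebra.of P y) = (f.1 ν).1 p := by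
  rw [comp_apply, coord_apply_of]

/-- If `Var(H) = Lie-P`, then there are no identities between Lie polynomial functions on the
affine spaces. -/
theorem eq_of_forall_hom_eq (hH : VarEqLie P H) {X : Finset 𝒰} {p q : FreeLieAlgebra P X}
    (h : ∀ ν : FreeLieAlgebra P X →ₗ⁅P⁆ H, ν p = ν q) : p = q := by
  let e := X.equivFin
  let f : X → ℕ := fun y => e y
  have hf : Function.Injective f := Fin.val_injective.comp e.injective
  have h1 : IsLieIdentity P H (FreeLieAlgebra.map P f p) (FreeLieAlgebra.map P f q) :=
    fun ν => h (ν.comp (FreeLieAlgebra.map P f))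
  have h2 := hH.memVar P (FreeLieAlgebra P X) _ _ h1
  by_cases hX : Nonempty X
  · have h3 := h2 (FreeLieAlgebra.map P (Function.invFun f))
    have h4 (r : FreeLieAlgebra P X) :
        FreeLieAlgebra.map P (Function.invFun f) (FreeLieAlgebra.map P f r) = r := by
      have : (FreeLieAlgebra.map P (Function.invFun f)).comp (FreeLieAlgebra.map P f) =
          LieHom.id := by
        ext y
        simp [Function.leftInverse_invFun hf y]
      exact LieHom.congr_fun this r
    rwa [h4, h4] at h3
  · have h5 (r : FreeLieAlgebra P X) : r = 0 := by
      have : (LieHom.id : FreeLieAlgebra P X →ₗ⁅P⁆ FreeLieAlgebra P X) = 0 := by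
        ext y
        exact absurd ⟨y⟩ hX
      exact LieHom.congr_fun this r
    rw [h5 p, h5 q]

/-- The functions on the affine space `Hom(W(X), H)` are the elements of `W(X)`. -/
noncomputable def coordEquiv (hH : VarEqLie P H) (x : 𝒰) (X : Finset 𝒰) :
    FreeLieAlgebra P X ≃ (aff (P := P) H X ⟶ aff H {x}) :=
  Equiv.ofBijective (fun p => coord x (V := aff H X) p)
    ⟨fun _ _ h => eq_of_forall_hom_eq hH fun ν => coord_eq_coord_iff.mp h ν trivial,
      fun f => (exists_eq_coord f).imp fun _ h => h.symm⟩

@[simp] theorem coordEquiv_apply (hH : VarEqLie P H) (x : 𝒰) (X : Finset 𝒰)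
    (p : FreeLieAlgebra P X) : coordEquiv hH x X p = coord x (V := aff H X) p := rfl

theorem aff_hom_ext {V : AlgSetCat P 𝒰 H} {X : Finset 𝒰} {f g : V ⟶ aff H X}
    (h : ∀ y : X, f ≫ coord x (V := aff H X) (FreeLieAlgebra.of P y) =
      g ≫ coord x (V := aff H X) (FreeLieAlgebra.of P y)) : f = g :=
  hom_ext fun ν y => by
    have := comp_coord_apply_of (x := x) f (FreeLieAlgebra.of P y) ν
      ⟨x, Finset.mem_singleton_self x⟩
    rw [← this]
    rw [h y]
    rw [comp_coord_apply_of]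

/-- The affine space `Hom(W(X), H)` is the power of the affine line with exponent `X`. The
projections are composed with an isomorphism `k` of the affine line with another object. -/
noncomputable def isLimitAff (x : 𝒰) (X : Finset 𝒰) {A : AlgSetCat P 𝒰 H} (k : aff H {x} ≅ A) :
    Limits.IsLimit (Limits.Fan.mk (aff (P := P) H X) fun y : X =>
      coord x (V := aff H X) (FreeLieAlgebra.of P y) ≫ k.hom) :=
  Limits.Fan.IsLimit.mk _
    (fun s => ofHom (V' := aff H X)
      (FreeLieAlgebra.lift P fun y => (exists_eq_coord (s.proj y ≫ k.inv)).choose)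
      fun _ _ => Set.mem_univ _)
    (fun s y => by
      dsimp
      rw [← Category.assoc, ofHom_comp_coord]
      rw [FreeLieAlgebra.lift_of_apply, ← (exists_eq_coord (s.proj y ≫ k.inv)).choose_spec]
      simp)
    (fun s m hm => by
      refine aff_hom_ext (x := x) fun y => ?_
      rw [ofHom_comp_coord, FreeLieAlgebra.lift_of_apply,
        ← (exists_eq_coord (s.proj y ≫ k.inv)).choose_spec, Iso.eq_comp_inv, ← hm y]
      simp)

/-! ### The affine line -/

theorem isIso_of_ne_zero (f : aff (P := P) H {x} ⟶ aff H {x}) (hf : f ≠ 0) : IsIso f := by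
  obtain ⟨p, rfl⟩ := exists_eq_coord f
  let _ : Unique ({x} : Finset 𝒰) :=
    ⟨⟨⟨x, Finset.mem_singleton_self x⟩⟩, fun y => Subtype.ext (Finset.mem_singleton.mp y.2)⟩
  obtain ⟨c, hc⟩ := FreeLieAlgebra.exists_eq_smul_of (X := ({x} : Finset 𝒰)) p
  have hc' (d : P) (ν : (aff (P := P) H {x}).pts) (y : (aff (P := P) H {x}).vars) :
      ((coord x (V := aff H {x}) (d • FreeLieAlgebra.of P default)).1 ν).1 (FreeLieAlgebra.of P y) =
        d • ν.1 (FreeLieAlgebra.of P y) := by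
    rw [coord_apply_of, map_smul]
    congr 3
    exact (Subtype.ext (Finset.mem_singleton.mp y.2)).symm
  have hc0 : c ≠ 0 := by
    rintro rfl
    refine hf (hom_ext fun ν y => ?_)
    rw [hc, hc', zero_apply, zero_smul]
  refine ⟨coord x (V := aff H {x}) (c⁻¹ • FreeLieAlgebra.of P default), hom_ext fun ν y => ?_,
    hom_ext fun ν y => ?_⟩
  · rw [comp_apply, hc', hc, hc', smul_smul, inv_mul_cancel₀ hc0, one_smul]
    rfl
  · rw [comp_apply, hc, hc', hc', smul_smul, mul_inv_cancel₀ hc0, one_smul]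
    rfl

theorem id_line_ne_zero (hH : VarEqLie P H) : 𝟙 (aff (P := P) H {x}) ≠ 0 := by
  intro h
  let t : FreeLieAlgebra P ({x} : Finset 𝒰) :=
    FreeLieAlgebra.of P ⟨x, Finset.mem_singleton_self x⟩
  have : t = 0 := by
    refine eq_of_forall_hom_eq hH fun ν => ?_
    rw [map_zero]
    have := congrArg (fun f : aff (P := P) H {x} ⟶ aff H {x} => (f.1 ⟨ν, trivial⟩).1 t) h
    exact this.trans (zero_apply _ _ _ _)
  exact FreeLieAlgebra.of_ne_zero _ this

theorem exists_ne_zero_to_line {V : AlgSetCat P 𝒰 H} (hV : 𝟙 V ≠ 0) :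
    ∃ f : V ⟶ aff H {x}, f ≠ 0 := by
  by_contra! h
  refine hV (hom_ext fun ν y => ?_)
  have := coord_apply_of (x := x) (FreeLieAlgebra.of P y) ν ⟨x, Finset.mem_singleton_self x⟩
  rw [h (coord x _), zero_apply] at this
  rw [zero_apply]
  exact this.symm

/-- A function which is not zero, followed by a nonzero morphism from the affine line, is not
zero: the second map multiplies the only coordinate by constants. -/
theorem comp_ne_zero_of_line {V V' : AlgSetCat P 𝒰 H} {f : V ⟶ aff H {x}} (hf : f ≠ 0)
    {g : aff H {x} ⟶ V'} (hg : g ≠ 0) : f ≫ g ≠ 0 := by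
  intro h
  obtain ⟨t, ht, rfl⟩ := exists_eq_ofHom g
  let _ : Unique ({x} : Finset 𝒰) :=
    ⟨⟨⟨x, Finset.mem_singleton_self x⟩⟩, fun y => Subtype.ext (Finset.mem_singleton.mp y.2)⟩
  refine hg (hom_ext fun μ y => ?_)
  obtain ⟨c, hc⟩ := FreeLieAlgebra.exists_eq_smul_of (X := ({x} : Finset 𝒰))
    (t (FreeLieAlgebra.of P y))
  have hc0 : c = 0 := by
    by_contra hc0
    refine hf (hom_ext fun ν z => ?_)
    have := congrArg (fun f : V ⟶ V' => (f.1 ν).1 (FreeLieAlgebra.of P y)) h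
    rw [comp_apply, ofHom_apply, zero_apply] at this
    rw [hc, map_smul, smul_eq_zero] at this
    rw [zero_apply, Subsingleton.elim (α := ({x} : Finset 𝒰)) z default]
    exact this.resolve_left hc0
  rw [ofHom_apply, zero_apply]
  rw [hc, hc0, zero_smul, map_zero]

end AlgSetCat

/-! ### Equivalences of categories of algebraic sets -/

/-- The reason why equivalences preserve the affine line: if in a category every nonzero endomorphism
of `ℓ` is invertible, and in an equivalent category every nonzero object has a nonzero morphism to
`ℓ'`, which moreover cannot be annihilated by nonzero morphisms from `ℓ'`, then `ℓ` corresponds to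
`ℓ'`. -/
theorem nonempty_iso_of_equivalence {C : Type*} [Category C] [Limits.HasZeroMorphisms C]
    {D : Type*} [Category D] [Limits.HasZeroMorphisms D] (E : C ≌ D) {ℓ : C} {ℓ' : D}
    (hℓ : 𝟙 ℓ ≠ 0) (hℓ' : 𝟙 ℓ' ≠ 0) (hiso : ∀ f : ℓ ⟶ ℓ, f ≠ 0 → IsIso f)
    (hiso' : ∀ f : ℓ' ⟶ ℓ', f ≠ 0 → IsIso f) (hto : ∀ V : C, 𝟙 V ≠ 0 → ∃ f : V ⟶ ℓ, f ≠ 0)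
    (hto' : ∀ V : D, 𝟙 V ≠ 0 → ∃ f : V ⟶ ℓ', f ≠ 0)
    (hcomp : ∀ (V V' : D) (f : V ⟶ ℓ') (g : ℓ' ⟶ V'), f ≠ 0 → g ≠ 0 → f ≫ g ≠ 0) :
    Nonempty (E.functor.obj ℓ ≅ ℓ') := by
  have hne {V V' : C} {f : V ⟶ V'} (hf : f ≠ 0) : E.functor.map f ≠ 0 := fun h =>
    hf (E.functor.map_injective (h.trans (E.functor.map_zero V V').symm))
  have hne' {V V' : D} {f : V ⟶ V'} (hf : f ≠ 0) : E.inverse.map f ≠ 0 := fun h =>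
    hf (E.inverse.map_injective (h.trans (E.inverse.map_zero V V').symm))
  obtain ⟨f, hf⟩ := hto' (E.functor.obj ℓ) (by simpa using hne hℓ)
  obtain ⟨h, hh⟩ := hto (E.inverse.obj ℓ') (by simpa using hne' hℓ')
  let g : ℓ' ⟶ E.functor.obj ℓ := E.counitInv.app ℓ' ≫ E.functor.map h
  have hg : g ≠ 0 := fun h0 => hne hh (by
    rw [← cancel_epi (E.counitInv.app ℓ'), Limits.comp_zero]
    exact h0)
  have hfg := hcomp _ _ f g hf hg
  obtain ⟨k, hk⟩ := E.functor.map_surjective (f ≫ g)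
  have hk0 : k ≠ 0 := by
    rintro rfl
    exact hfg (by rw [← hk, E.functor.map_zero])
  have := hiso k hk0
  have hI : IsIso (f ≫ g) := hk ▸ inferInstance
  let r := inv (f ≫ g)
  have hr : f ≫ g ≫ r = 𝟙 _ := by
    rw [← Category.assoc]
    exact IsIso.hom_inv_id (f ≫ g)
  -- the idempotent `g ≫ r ≫ f` of `ℓ'` is not zero, hence invertible, hence the identity
  have he : f ≫ g ≫ r ≫ f = f := by
    rw [← Category.assoc g, ← Category.assoc f, hr, Category.id_comp]
  have hI' : IsIso (g ≫ r ≫ f) := hiso' _ fun h0 => hf (by rw [← he, h0, Limits.comp_zero])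
  have hid : g ≫ r ≫ f = 𝟙 _ := by
    rw [← cancel_epi (g ≫ r ≫ f)]
    simp only [Category.assoc, Category.comp_id]
    rw [he]
  exact ⟨⟨f, g ≫ r, hr, by rw [Category.assoc, hid]⟩⟩

namespace AlgSetCat

variable {P : Type u} [Field P] {𝒰 : Type a}
  {H : Type v} [LieRing H] [LieAlgebra P H]

/-- The closure of a system of equations in terms of the category of algebraic sets. -/
theorem mem_eqClosure_iff (x : 𝒰) {X : Finset 𝒰} {T : Set (FreeLieAlgebra P X × FreeLieAlgebra P X)}
    {p q : FreeLieAlgebra P X} : (p, q) ∈ eqClosure H T ↔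
      ∀ (V : AlgSetCat P 𝒰 H) (f : V ⟶ aff H X),
        (∀ b ∈ T, f ≫ coord x (V := aff H X) b.1 = f ≫ coord x (V := aff H X) b.2) →
        f ≫ coord x (V := aff H X) p = f ≫ coord x (V := aff H X) q := by
  constructor
  · intro h V f hf
    refine hom_ext fun ν y => ?_
    rw [comp_coord_apply_of, comp_coord_apply_of]
    refine h _ fun b hb => ?_
    rw [← comp_coord_apply_of (x := x) f b.1 ν y, hf b hb, comp_coord_apply_of]
  · intro h μ hμ
    let V : AlgSetCat P 𝒰 H := ⟨X, solutions H T, T, rfl⟩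
    let f : V ⟶ aff H X := ofHom (V := V) (V' := aff H X) LieHom.id fun _ _ => Set.mem_univ _
    have hf (p : FreeLieAlgebra P X) : f ≫ coord x (V := aff H X) p = coord x (V := V) p :=
      ofHom_comp_coord (V := V) (V' := aff H X) _ _ p
    have := h V f fun b hb => by
      rw [hf, hf, coord_eq_coord_iff]
      exact fun ν hν => hν b hb
    rw [hf, hf, coord_eq_coord_iff] at this
    exact this μ hμ

variable {H₁ : Type v} [LieRing H₁] [LieAlgebra P H₁] {H₂ : Type w} [LieRing H₂] [LieAlgebra P H₂]

/-- An equivalence of categories of algebraic sets preserves the affine spaces, and acts on the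
functions on them by substitutive bijections of the algebras `W(X)`, which transform closures into
closures. -/
theorem exists_isSubstitutive (h₁ : VarEqLie P H₁) (h₂ : VarEqLie P H₂) [Nonempty 𝒰]
    (E : AlgSetCat P 𝒰 H₁ ≌ AlgSetCat P 𝒰 H₂) :
    ∃ s : ∀ X : Finset 𝒰, FreeLieAlgebra P X → FreeLieAlgebra P X,
      FreeLieAlgebra.IsSubstitutive s ∧
      ∀ (X : Finset 𝒰) (T : Set (FreeLieAlgebra P X × FreeLieAlgebra P X)) (p q),
        (p, q) ∈ eqClosure H₁ T ↔ (s X p, s X q) ∈ eqClosure H₂ (Prod.map (s X) (s X) '' T) := by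
  obtain ⟨x⟩ := (inferInstance : Nonempty 𝒰)
  obtain ⟨j⟩ : Nonempty (E.functor.obj (aff H₁ {x}) ≅ aff H₂ {x}) :=
    nonempty_iso_of_equivalence E (id_line_ne_zero h₁) (id_line_ne_zero h₂) isIso_of_ne_zero
      isIso_of_ne_zero (fun _ => exists_ne_zero_to_line) (fun _ => exists_ne_zero_to_line)
      fun _ _ _ _ hf hg => comp_ne_zero_of_line hf hg
  have hi (X : Finset 𝒰) : ∃ i : E.functor.obj (aff H₁ X) ≅ aff H₂ X, ∀ y : X,
      i.inv ≫ E.functor.map (coord x (V := aff H₁ X) (FreeLieAlgebra.of P y)) ≫ j.hom =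
        coord x (V := aff H₂ X) (FreeLieAlgebra.of P y) := by
    let t₁ := Limits.isLimitFanMkObjOfIsLimit E.functor _ _ (isLimitAff x X (Iso.refl (aff H₁ {x})))
    let t₂ := isLimitAff x X j.symm
    let i := t₁.conePointUniqueUpToIso t₂
    refine ⟨i, fun y => ?_⟩
    have := t₁.conePointUniqueUpToIso_inv_comp t₂ ⟨y⟩
    rw [← Category.assoc, ← Iso.eq_comp_inv]
    exact (congrArg (fun f => i.inv ≫ E.functor.map f) (Category.comp_id _).symm).trans this
  choose i hi using hi
  -- the action of `E` on the functions on the affine spaces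
  let s (X : Finset 𝒰) (p : FreeLieAlgebra P X) : FreeLieAlgebra P X :=
    (coordEquiv h₂ x X).symm
      ((i X).inv ≫ E.functor.map (coord x (V := aff H₁ X) p) ≫ j.hom)
  have hs (X : Finset 𝒰) (p : FreeLieAlgebra P X) : coord x (V := aff H₂ X) (s X p) =
      (i X).inv ≫ E.functor.map (coord x (V := aff H₁ X) p) ≫ j.hom :=
    (coordEquiv h₂ x X).apply_symm_apply _
  refine ⟨s, ⟨fun X => ⟨fun p q h => ?_, fun q => ?_⟩, fun X y => ?_, fun X Y f p => ?_⟩,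
    fun X T p q => ?_⟩
  · have h' := congrArg (coordEquiv h₂ x X) h
    simp only [coordEquiv_apply, hs, cancel_epi, cancel_mono] at h'
    exact (coordEquiv h₁ x X).injective (E.functor.map_injective h')
  · obtain ⟨g, hg⟩ := E.functor.map_surjective
      ((i X).hom ≫ coord x (V := aff H₂ X) q ≫ j.inv)
    obtain ⟨p, rfl⟩ := exists_eq_coord g
    refine ⟨p, (coordEquiv h₂ x X).injective ?_⟩
    rw [coordEquiv_apply, hs, hg]
    simp
  · refine (coordEquiv h₂ x X).injective ?_
    rw [coordEquiv_apply, hs, hi, coordEquiv_apply]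
  · let F : aff H₁ X ⟶ aff H₁ Y :=
      ofHom (V := aff H₁ X) (V' := aff H₁ Y) f fun _ _ => Set.mem_univ _
    let f' := FreeLieAlgebra.lift P fun y => s X (f (FreeLieAlgebra.of P y))
    let F' : aff H₂ X ⟶ aff H₂ Y :=
      ofHom (V := aff H₂ X) (V' := aff H₂ Y) f' fun _ _ => Set.mem_univ _
    have hF (q : FreeLieAlgebra P Y) : F ≫ coord x (V := aff H₁ Y) q =
        coord x (V := aff H₁ X) (f q) := ofHom_comp_coord (V := aff H₁ X) (V' := aff H₁ Y) _ _ q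
    have hF' (q : FreeLieAlgebra P Y) : F' ≫ coord x (V := aff H₂ Y) q =
        coord x (V := aff H₂ X) (f' q) := ofHom_comp_coord (V := aff H₂ X) (V' := aff H₂ Y) _ _ q
    have hFF : (i X).inv ≫ E.functor.map F ≫ (i Y).hom = F' := by
      refine aff_hom_ext (x := x) fun y => ?_
      rw [hF', FreeLieAlgebra.lift_of_apply, hs, ← hF, ← hi]
      simp
    refine (coordEquiv h₂ x X).injective ?_
    rw [coordEquiv_apply, coordEquiv_apply, hs, ← hF, ← hF', hs, ← hFF]
    simp
  · rw [mem_eqClosure_iff x, mem_eqClosure_iff x]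
    constructor
    · intro h V f hf
      let c := E.counitIso.app V
      obtain ⟨g, hg⟩ := E.functor.map_surjective (c.hom ≫ f ≫ (i X).inv)
      have hgp (p : FreeLieAlgebra P X) : E.functor.map (g ≫ coord x (V := aff H₁ X) p) =
          c.hom ≫ (f ≫ coord x (V := aff H₂ X) (s X p)) ≫ j.inv := by
        rw [E.functor.map_comp, hg, hs]
        simp
      have := h _ g fun b hb => E.functor.map_injective (by
        rw [hgp, hgp]
        congr 2
        exact hf (s X b.1, s X b.2) ⟨b, hb, rfl⟩)
      have := congrArg E.functor.map this
      rwa [hgp, hgp, cancel_epi, cancel_mono] at this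
    · intro h V f hf
      have hfp (p : FreeLieAlgebra P X) : (E.functor.map f ≫ (i X).hom) ≫
          coord x (V := aff H₂ X) (s X p) =
          E.functor.map (f ≫ coord x (V := aff H₁ X) p) ≫ j.hom := by
        rw [hs]
        simp
      have := h _ (E.functor.map f ≫ (i X).hom) (by
        rintro _ ⟨b, hb, rfl⟩
        dsimp only [Prod.map]
        rw [hfp, hfp, hf b hb])
      rw [hfp, hfp, cancel_mono] at this
      exact E.functor.map_injective this

end AlgSetCat

/-! ### Semilinear automorphisms of free Lie algebras and twisted algebras -/

/-- A `σ`-semilinear automorphism of the Lie ring `L`. -/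
structure SemiLieEquiv {P : Type u} [Field P] (σ : P ≃+* P) (L : Type v) [LieRing L]
    [LieAlgebra P L] extends L ≃ L where
  map_add' : ∀ b c, toFun (b + c) = toFun b + toFun c
  map_smul' : ∀ (r : P) b, toFun (r • b) = σ r • toFun b
  map_lie' : ∀ b c, toFun ⁅b, c⁆ = ⁅toFun b, toFun c⁆

theorem Twist.map_smul {P : Type u} [Field P] (σ : P ≃+* P) {H : Type v} [LieRing H]
    [LieAlgebra P H] (r : P) (b : H) :
    @HSMul.hSMul P (Twist σ H) (Twist σ H) _ (σ r) b = r • b := by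
  change σ.symm (σ r) • b = r • b
  rw [RingEquiv.symm_apply_apply]

namespace SemiLieEquiv

variable {P : Type u} [Field P] {σ : P ≃+* P} {L : Type v} [LieRing L] [LieAlgebra P L]

instance : CoeFun (SemiLieEquiv σ L) fun _ => L → L := ⟨fun e => e.toEquiv⟩

theorem map_add (e : SemiLieEquiv σ L) (b c : L) : e (b + c) = e b + e c := e.map_add' b c

theorem map_smul (e : SemiLieEquiv σ L) (r : P) (b : L) : e (r • b) = σ r • e b := e.map_smul' r b

theorem map_lie (e : SemiLieEquiv σ L) (b c : L) : e ⁅b, c⁆ = ⁅e b, e c⁆ := e.map_lie' b c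

/-- The inverse automorphism, which is `σ⁻¹`-semilinear. -/
def symm (e : SemiLieEquiv σ L) : SemiLieEquiv σ.symm L where
  toEquiv := e.toEquiv.symm
  map_add' b c := e.toEquiv.injective (by
    change _ = e (_ + _)
    rw [e.map_add]
    simp)
  map_smul' r b := e.toEquiv.injective (by
    change _ = e (_ • _)
    rw [e.map_smul]
    simp)
  map_lie' b c := e.toEquiv.injective (by
    change _ = e ⁅_, _⁆
    rw [e.map_lie]
    simp)

@[simp] theorem apply_symm_apply (e : SemiLieEquiv σ L) (b : L) : e (e.symm b) = b :=
  e.toEquiv.apply_symm_apply b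

@[simp] theorem symm_apply_apply (e : SemiLieEquiv σ L) (b : L) : e.symm (e b) = b :=
  e.toEquiv.symm_apply_apply b

variable {L' : Type w} [LieRing L'] [LieAlgebra P L']

/-- The conjugate `e' ∘ f ∘ e⁻¹` of a homomorphism by semilinear automorphisms. -/
def conj (e : SemiLieEquiv σ L) (e' : SemiLieEquiv σ L') (f : L →ₗ⁅P⁆ L') : L →ₗ⁅P⁆ L' where
  toFun b := e' (f (e.symm b))
  map_add' b c := by rw [e.symm.map_add, _root_.map_add, e'.map_add]
  map_smul' r b := by
    rw [e.symm.map_smul, _root_.map_smul, e'.map_smul, RingEquiv.apply_symm_apply]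
    rfl
  map_lie' {b c} := by rw [e.symm.map_lie, LieHom.map_lie, e'.map_lie]

theorem conj_symm_conj (e : SemiLieEquiv σ L) (e' : SemiLieEquiv σ L') (f : L →ₗ⁅P⁆ L') :
    e.symm.conj e'.symm (e.conj e' f) = f := by
  ext b
  change e'.symm (e' (f (e.symm (e b)))) = f b
  rw [e'.symm_apply_apply, e.symm_apply_apply]

/-- The homomorphism `f ∘ e⁻¹` to the twisted algebra `H^σ`. -/
def twistHom (e : SemiLieEquiv σ L) (f : L →ₗ⁅P⁆ L') : L →ₗ⁅P⁆ Twist σ L' where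
  toFun b := f (e.symm b)
  map_add' b c := by
    rw [e.symm.map_add, _root_.map_add]
    rfl
  map_smul' r b := by
    rw [e.symm.map_smul, _root_.map_smul]
    rfl
  map_lie' {b c} := by
    rw [e.symm.map_lie, LieHom.map_lie]
    rfl

/-- The homomorphism `f ∘ e` for a homomorphism `f` to the twisted algebra `H^σ`. -/
def untwistHom (e : SemiLieEquiv σ L) (f : L →ₗ⁅P⁆ Twist σ L') : L →ₗ⁅P⁆ L' where
  toFun b := f (e b)
  map_add' b c := by
    rw [e.map_add, _root_.map_add]
    rfl
  map_smul' r b := by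
    rw [e.map_smul, _root_.map_smul]
    exact Twist.map_smul (H := L') σ r _
  map_lie' {b c} := (congrArg f (e.map_lie b c)).trans (f.map_lie' (x := e b) (y := e c))

/-- Passing to `H^σ` transforms closures by a semilinear automorphism of the free Lie algebra. -/
theorem mem_eqClosure_twist_iff {X : Type a} (e : SemiLieEquiv σ (FreeLieAlgebra P X))
    (T : Set (FreeLieAlgebra P X × FreeLieAlgebra P X)) (p q : FreeLieAlgebra P X) :
    (e p, e q) ∈ eqClosure (Twist σ L) (Prod.map e e '' T) ↔ (p, q) ∈ eqClosure L T := by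
  constructor
  · intro h μ hμ
    have := h (e.twistHom μ) (by
      rintro _ ⟨b, hb, rfl⟩
      change μ (e.symm (e b.1)) = μ (e.symm (e b.2))
      rw [e.symm_apply_apply, e.symm_apply_apply]
      exact hμ b hb)
    change μ (e.symm (e p)) = μ (e.symm (e q)) at this
    rwa [e.symm_apply_apply, e.symm_apply_apply] at this
  · intro h μ hμ
    exact h (e.untwistHom μ) fun b hb => hμ (e b.1, e b.2) ⟨b, hb, rfl⟩

end SemiLieEquiv

namespace FreeLieAlgebra

variable {P : Type u} [Field P] {X : Type a}

/-- The homomorphism `W(X) → W(X)^(σ⁻¹)` which fixes the variables. -/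
noncomputable def scalarHom (σ : P ≃+* P) (X : Type a) :
    FreeLieAlgebra P X →ₗ⁅P⁆ Twist σ.symm (FreeLieAlgebra P X) :=
  lift P (L := Twist σ.symm (FreeLieAlgebra P X)) fun x => of P x

/-- The endomorphism of the Lie ring `W(X)` which fixes the variables and acts by `σ` on the
scalars. -/
noncomputable def scalarMap (σ : P ≃+* P) (b : FreeLieAlgebra P X) : FreeLieAlgebra P X :=
  scalarHom σ X b

theorem scalarMap_of (σ : P ≃+* P) (x : X) : scalarMap σ (of P x) = of P x :=
  lift_of_apply (L := Twist σ.symm (FreeLieAlgebra P X)) _ x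

theorem scalarMap_add (σ : P ≃+* P) (b c : FreeLieAlgebra P X) :
    scalarMap σ (b + c) = scalarMap σ b + scalarMap σ c := (scalarHom σ X).map_add' b c

theorem scalarMap_smul (σ : P ≃+* P) (r : P) (b : FreeLieAlgebra P X) :
    scalarMap σ (r • b) = σ r • scalarMap σ b := (scalarHom σ X).map_smul' r b

theorem scalarMap_lie (σ : P ≃+* P) (b c : FreeLieAlgebra P X) :
    scalarMap σ ⁅b, c⁆ = ⁅scalarMap σ b, scalarMap σ c⁆ :=
  (scalarHom σ X).map_lie' (x := b) (y := c)

theorem scalarMap_symm_scalarMap (σ : P ≃+* P) (b : FreeLieAlgebra P X) :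
    scalarMap σ.symm (scalarMap σ b) = b := by
  induction b using induction with
  | zero =>
    rw [← zero_smul P 0, scalarMap_smul, scalarMap_smul, map_zero, map_zero, zero_smul, zero_smul]
  | of x => rw [scalarMap_of, scalarMap_of]
  | add b c hb hc => rw [scalarMap_add, scalarMap_add, hb, hc]
  | smul r b hb => rw [scalarMap_smul, scalarMap_smul, hb, RingEquiv.symm_apply_apply]
  | lie b c hb hc => rw [scalarMap_lie, scalarMap_lie, hb, hc]

/-- The `σ`-semilinear automorphism of `W(X)` which fixes the variables. -/
noncomputable def scalarEquiv (σ : P ≃+* P) (X : Type a) : SemiLieEquiv σ (FreeLieAlgebra P X) where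
  toFun := scalarMap σ
  invFun := scalarMap σ.symm
  left_inv := scalarMap_symm_scalarMap σ
  right_inv := scalarMap_symm_scalarMap σ.symm
  map_add' := scalarMap_add σ
  map_smul' := scalarMap_smul σ
  map_lie' := scalarMap_lie σ

end FreeLieAlgebra

/-- If `s` is additive, semilinear and multiplies brackets by `κ`, then `κ • s` is an automorphism of
Lie rings. As equations over a field may be multiplied by `κ`, it transforms closures as `s` does. -/
theorem twistedGeomEquiv_of_equivalence {P : Type u} [Field P] {𝒰 : Type a} [Infinite 𝒰]
    {H₁ : Type v} [LieRing H₁] [LieAlgebra P H₁] {H₂ : Type w} [LieRing H₂] [LieAlgebra P H₂]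
    (h₁ : VarEqLie P H₁) (h₂ : VarEqLie P H₂) (E : AlgSetCat P 𝒰 H₁ ≌ AlgSetCat P 𝒰 H₂) :
    TwistedGeomEquiv P 𝒰 H₁ H₂ := by
  obtain ⟨s, hs, hcl⟩ := AlgSetCat.exists_isSubstitutive h₁ h₂ E
  obtain ⟨σ, κ, hκ, hsemi⟩ := hs.exists_semilinear
  refine ⟨σ, fun X T => ?_⟩
  obtain ⟨hadd, hsmul, hlie⟩ := hsemi X
  let e : SemiLieEquiv σ (FreeLieAlgebra P X) :=
    { toEquiv := (Equiv.ofBijective _ (hs.bijective X)).trans (MulAction.toPerm (Units.mk0 κ hκ))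
      map_add' := fun b c => by
        change κ • s X (b + c) = κ • s X b + κ • s X c
        rw [hadd, smul_add]
      map_smul' := fun r b => by
        change κ • s X (r • b) = σ r • κ • s X b
        rw [hsmul, smul_comm]
      map_lie' := fun b c => by
        change κ • s X ⁅b, c⁆ = ⁅κ • s X b, κ • s X c⁆
        rw [hlie, smul_lie, lie_smul] }
  have he (b : FreeLieAlgebra P X) : e b = κ • s X b := rfl
  have hT : T = Prod.map e e '' (Prod.map e e ⁻¹' T) :=
    (Set.image_preimage_eq _ (e.surjective.prodMap e.surjective)).symm
  ext ⟨p', q'⟩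
  obtain ⟨p, rfl⟩ := e.surjective p'
  obtain ⟨q, rfl⟩ := e.surjective q'
  change (e p, e q) ∈ _ ↔ (e p, e q) ∈ _
  rw [hT, e.mem_eqClosure_twist_iff, hcl]
  have hμ (μ : FreeLieAlgebra P X →ₗ⁅P⁆ H₂) (b c : FreeLieAlgebra P X) :
      μ (s X b) = μ (s X c) ↔ μ (e b) = μ (e c) := by
    rw [he, he, map_smul, map_smul, (smul_right_injective H₂ hκ).eq_iff]
  have hsol : solutions H₂ (Prod.map (s X) (s X) '' (Prod.map e e ⁻¹' T)) =
      solutions H₂ (Prod.map e e '' (Prod.map e e ⁻¹' T)) := by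
    ext μ
    constructor
    · rintro h _ ⟨b, hb, rfl⟩
      exact (hμ μ _ _).mp (h _ ⟨b, hb, rfl⟩)
    · rintro h _ ⟨b, hb, rfl⟩
      exact (hμ μ _ _).mpr (h _ ⟨b, hb, rfl⟩)
  rw [eqClosure, eqClosure, hsol]
  exact forall₂_congr fun μ _ => hμ μ p q

/-! ### Correct isomorphisms from twisted geometrical equivalence -/

theorem solutions_eqClosure {P : Type u} [Field P] {H : Type v} [LieRing H] [LieAlgebra P H]
    {X : Type a} (T : Set (FreeLieAlgebra P X × FreeLieAlgebra P X)) :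
    solutions H (eqClosure H T) = solutions H T :=
  Set.Subset.antisymm (fun _ hμ b hb => hμ b fun _ hν => hν b hb) fun μ hμ _ hb => hb μ hμ

namespace AlgSetCat

variable {P : Type u} [Field P] {𝒰 : Type a} {H : Type v} [LieRing H] [LieAlgebra P H]

theorem ofHom_eq_ofHom_iff {V V' : AlgSetCat P 𝒰 H}
    {t t' : FreeLieAlgebra P V'.vars →ₗ⁅P⁆ FreeLieAlgebra P V.vars}
    {h : ∀ ν ∈ V.pts, ν.comp t ∈ V'.pts} {h' : ∀ ν ∈ V.pts, ν.comp t' ∈ V'.pts} :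
    ofHom t h = ofHom t' h' ↔ ∀ p, (t p, t' p) ∈ commonKer V.pts := by
  constructor
  · intro hf p ν hν
    have := congrArg (fun f : V ⟶ V' => (f.1 ⟨ν, hν⟩).1 p) hf
    exact this
  · exact fun hf => hom_ext fun ν y => hf _ ν.1 ν.2

theorem id_eq_ofHom (V : AlgSetCat P 𝒰 H) : 𝟙 V = ofHom LieHom.id fun _ hν => hν := rfl

theorem ofHom_comp_ofHom {V V' V'' : AlgSetCat P 𝒰 H}
    (t : FreeLieAlgebra P V'.vars →ₗ⁅P⁆ FreeLieAlgebra P V.vars)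
    (h : ∀ ν ∈ V.pts, ν.comp t ∈ V'.pts)
    (t' : FreeLieAlgebra P V''.vars →ₗ⁅P⁆ FreeLieAlgebra P V'.vars)
    (h' : ∀ ν ∈ V'.pts, ν.comp t' ∈ V''.pts) :
    ofHom t h ≫ ofHom t' h' = ofHom (t.comp t') fun ν hν => h' _ (h ν hν) := rfl

theorem heq_ofHom {X Y : Finset 𝒰} {A A' : Set (FreeLieAlgebra P X →ₗ⁅P⁆ H)}
    {B B' : Set (FreeLieAlgebra P Y →ₗ⁅P⁆ H)} {hA : IsAlgebraicSet A} {hA' : IsAlgebraicSet A'}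
    {hB : IsAlgebraicSet B} {hB' : IsAlgebraicSet B'} (hAA' : A = A') (hBB' : B = B')
    {t t' : FreeLieAlgebra P Y →ₗ⁅P⁆ FreeLieAlgebra P X} (ht : t = t')
    (h : ∀ ν ∈ A, ν.comp t ∈ B) (h' : ∀ ν ∈ A', ν.comp t' ∈ B') :
    HEq (ofHom (V := ⟨X, A, hA⟩) (V' := ⟨Y, B, hB⟩) t h)
      (ofHom (V := ⟨X, A', hA'⟩) (V' := ⟨Y, B', hB'⟩) t' h') := by
  subst hAA' hBB' ht
  rfl

variable {H₁ : Type v} [LieRing H₁] [LieAlgebra P H₁] {H₂ : Type w} [LieRing H₂] [LieAlgebra P H₂]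
  {σ : P ≃+* P}

/-- The algebraic set over `H₂` which is defined by the image under semilinear automorphisms of the
equations of an algebraic set over `H₁`. -/
abbrev twistObj (H₂ : Type w) [LieRing H₂] [LieAlgebra P H₂]
    (e : ∀ X : Finset 𝒰, SemiLieEquiv σ (FreeLieAlgebra P X)) (V : AlgSetCat P 𝒰 H₁) :
    AlgSetCat P 𝒰 H₂ :=
  ⟨V.vars, solutions H₂ (Prod.map (e V.vars) (e V.vars) '' commonKer V.pts), _, rfl⟩

variable {e : ∀ X : Finset 𝒰, SemiLieEquiv σ (FreeLieAlgebra P X)}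

theorem comp_conj_mem_twistObj {V V' : AlgSetCat P 𝒰 H₁}
    {t : FreeLieAlgebra P V'.vars →ₗ⁅P⁆ FreeLieAlgebra P V.vars}
    (h : ∀ ν ∈ V.pts, ν.comp t ∈ V'.pts) :
    ∀ ν ∈ (twistObj H₂ e V).pts,
      ν.comp ((e V'.vars).conj (e V.vars) t) ∈ (twistObj H₂ e V').pts := by
  rintro ν hν _ ⟨b, hb, rfl⟩
  have := hν (e V.vars (t b.1), e V.vars (t b.2))
    ⟨(t b.1, t b.2), fun μ hμ => hb _ (h μ hμ), rfl⟩
  change ν (e V.vars (t ((e V'.vars).symm (e V'.vars b.1)))) =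
    ν (e V.vars (t ((e V'.vars).symm (e V'.vars b.2))))
  rwa [SemiLieEquiv.symm_apply_apply, SemiLieEquiv.symm_apply_apply]

theorem ofHom_conj_congr {V V' : AlgSetCat P 𝒰 H₁}
    {t t' : FreeLieAlgebra P V'.vars →ₗ⁅P⁆ FreeLieAlgebra P V.vars}
    {h : ∀ ν ∈ V.pts, ν.comp t ∈ V'.pts} {h' : ∀ ν ∈ V.pts, ν.comp t' ∈ V'.pts}
    (hf : ofHom t h = ofHom t' h') :
    ofHom (V := twistObj H₂ e V) (V' := twistObj H₂ e V') ((e V'.vars).conj (e V.vars) t)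
        (comp_conj_mem_twistObj h) =
      ofHom (V := twistObj H₂ e V) (V' := twistObj H₂ e V') ((e V'.vars).conj (e V.vars) t')
        (comp_conj_mem_twistObj h') := by
  rw [ofHom_eq_ofHom_iff] at hf
  exact ofHom_eq_ofHom_iff.mpr fun p ν hν => hν (_, _) ⟨_, hf ((e V'.vars).symm p), rfl⟩

/-- The functor from algebraic sets over `H₁` to algebraic sets over `H₂` induced by semilinear
automorphisms `e_X` of the algebras `W(X)`: it takes the morphism defined by `t` to the morphism
defined by `e ∘ t ∘ e⁻¹`. -/
noncomputable def twistFunctor (H₁ : Type v) [LieRing H₁] [LieAlgebra P H₁] (H₂ : Type w)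
    [LieRing H₂] [LieAlgebra P H₂] (e : ∀ X : Finset 𝒰, SemiLieEquiv σ (FreeLieAlgebra P X)) :
    AlgSetCat P 𝒰 H₁ ⥤ AlgSetCat P 𝒰 H₂ where
  obj V := twistObj H₂ e V
  map {V V'} f := ofHom (V := twistObj H₂ e V) (V' := twistObj H₂ e V')
    ((e V'.vars).conj (e V.vars) (exists_eq_ofHom f).choose)
    (comp_conj_mem_twistObj (exists_eq_ofHom f).choose_spec.choose)
  map_id V := by
    have h := (exists_eq_ofHom (𝟙 V)).choose_spec.choose_spec
    rw [ofHom_conj_congr (h.symm.trans (id_eq_ofHom V))]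
    exact hom_ext fun ν y => congrArg ν.1 ((e V.vars).apply_symm_apply _)
  map_comp {V V' V''} f g := by
    have hf := (exists_eq_ofHom f).choose_spec.choose_spec
    have hg := (exists_eq_ofHom g).choose_spec.choose_spec
    have hfg := (exists_eq_ofHom (f ≫ g)).choose_spec.choose_spec
    have h := (hfg.symm.trans (congrArg₂ (· ≫ ·) hf hg)).trans (ofHom_comp_ofHom _ _ _ _)
    rw [ofHom_conj_congr h]
    exact hom_ext fun ν y => congrArg
      (fun b => ν.1 (e V.vars ((exists_eq_ofHom f).choose b)))
      ((e V'.vars).symm_apply_apply _).symm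

theorem twistFunctor_map_ofHom {V V' : AlgSetCat P 𝒰 H₁}
    (t : FreeLieAlgebra P V'.vars →ₗ⁅P⁆ FreeLieAlgebra P V.vars)
    (h : ∀ ν ∈ V.pts, ν.comp t ∈ V'.pts) :
    (twistFunctor H₁ H₂ e).map (ofHom t h) = ofHom (V := twistObj H₂ e V) (V' := twistObj H₂ e V')
      ((e V'.vars).conj (e V.vars) t) (comp_conj_mem_twistObj h) :=
  ofHom_conj_congr (exists_eq_ofHom (ofHom t h)).choose_spec.choose_spec.symm

/-- The semilinear automorphisms `e_X` transform `H₁`-closures into `H₂`-closures. -/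
def PreservesClosure (H₁ : Type v) [LieRing H₁] [LieAlgebra P H₁] (H₂ : Type w)
    [LieRing H₂] [LieAlgebra P H₂] (e : ∀ X : Finset 𝒰, SemiLieEquiv σ (FreeLieAlgebra P X)) :
    Prop :=
  ∀ (X : Finset 𝒰) (T : Set (FreeLieAlgebra P X × FreeLieAlgebra P X)) (p q),
    (e X p, e X q) ∈ eqClosure H₂ (Prod.map (e X) (e X) '' T) ↔ (p, q) ∈ eqClosure H₁ T

theorem image_symm_image (X : Finset 𝒰) (T : Set (FreeLieAlgebra P X × FreeLieAlgebra P X)) :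
    Prod.map (e X).symm (e X).symm '' (Prod.map (e X) (e X) '' T) = T := by
  have h : Prod.map (e X).symm (e X).symm ∘ Prod.map (e X) (e X) = id := by
    ext b <;> simp
  rw [← Set.image_comp, h, Set.image_id]

theorem PreservesClosure.symm (he : PreservesClosure H₁ H₂ e) :
    PreservesClosure H₂ H₁ fun X => (e X).symm := by
  intro X T p q
  have := he X (Prod.map (e X).symm (e X).symm '' T) ((e X).symm p) ((e X).symm q)
  rw [(e X).apply_symm_apply, (e X).apply_symm_apply] at this
  rw [← this]
  have hT : Prod.map (e X) (e X) '' (Prod.map (e X).symm (e X).symm '' T) = T :=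
    image_symm_image (e := fun X => (e X).symm) X T
  rw [hT]

theorem PreservesClosure.image_eqClosure (he : PreservesClosure H₁ H₂ e) (X : Finset 𝒰)
    (T : Set (FreeLieAlgebra P X × FreeLieAlgebra P X)) :
    Prod.map (e X) (e X) '' eqClosure H₁ T = eqClosure H₂ (Prod.map (e X) (e X) '' T) := by
  ext ⟨p, q⟩
  constructor
  · rintro ⟨⟨p, q⟩, h, rfl, rfl⟩
    exact (he X T p q).mpr h
  · intro h
    refine ⟨((e X).symm p, (e X).symm q), (he X T _ _).mp ?_, by simp⟩
    rwa [(e X).apply_symm_apply, (e X).apply_symm_apply]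

theorem PreservesClosure.pts_twistObj (he : PreservesClosure H₁ H₂ e) (X : Finset 𝒰)
    (T : Set (FreeLieAlgebra P X × FreeLieAlgebra P X)) :
    solutions H₂ (Prod.map (e X) (e X) '' commonKer (solutions H₁ T)) =
      solutions H₂ (Prod.map (e X) (e X) '' T) := by
  change solutions H₂ (Prod.map (e X) (e X) '' eqClosure H₁ T) = _
  rw [he.image_eqClosure, solutions_eqClosure]

theorem PreservesClosure.twistFunctor_comp (he : PreservesClosure H₁ H₂ e) :
    twistFunctor H₁ H₂ e ⋙ twistFunctor H₂ H₁ (fun X => (e X).symm) = 𝟭 _ := by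
  have hpts (X : Finset 𝒰) (A : Set (FreeLieAlgebra P X →ₗ⁅P⁆ H₁)) (hA : IsAlgebraicSet A) :
      solutions H₁ (Prod.map (e X).symm (e X).symm '' commonKer
        (solutions H₂ (Prod.map (e X) (e X) '' commonKer A))) = A := by
    obtain ⟨T, rfl⟩ := hA
    rw [he.pts_twistObj]
    have := he.symm.pts_twistObj X (Prod.map (e X) (e X) '' T)
    rw [image_symm_image] at this
    exact this
  have hobj (V : AlgSetCat P 𝒰 H₁) :
      (twistFunctor H₁ H₂ e ⋙ twistFunctor H₂ H₁ (fun X => (e X).symm)).obj V = V := by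
    obtain ⟨X, A, hA⟩ := V
    simp only [Functor.comp_obj, twistFunctor, twistObj]
    congr
    exact hpts X A hA
  refine CategoryTheory.Functor.hext hobj fun V V' f => ?_
  obtain ⟨t, h, rfl⟩ := exists_eq_ofHom f
  obtain ⟨X, A, hA⟩ := V
  obtain ⟨Y, B, hB⟩ := V'
  rw [Functor.comp_map, twistFunctor_map_ofHom]
  refine (heq_of_eq (twistFunctor_map_ofHom _ _)).trans
    (heq_ofHom (hpts X A hA) (hpts Y B hB) (SemiLieEquiv.conj_symm_conj _ _ t) _ h)

end AlgSetCat

/-- The endofunctor of the category of free Lie algebras which is identical on objects, and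
conjugates homomorphisms by semilinear automorphisms. -/
noncomputable def conjFunctor {P : Type u} [Field P] {𝒰 : Type a} {σ : P ≃+* P}
    (e : ∀ X : Finset 𝒰, SemiLieEquiv σ (FreeLieAlgebra P X)) :
    FreeLieCat P 𝒰 ⥤ FreeLieCat P 𝒰 where
  obj X := X
  map {X Y} f := (e X.vars).conj (e Y.vars) f
  map_id X := by
    apply LieHom.ext
    intro b
    exact (e X.vars).apply_symm_apply b
  map_comp {X Y Z} f g := by
    apply LieHom.ext
    intro b
    exact congrArg (fun c => e Z.vars (LieHom.comp g LieHom.id c))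
      ((e Y.vars).symm_apply_apply (LieHom.comp f LieHom.id ((e X.vars).symm b))).symm

theorem conjFunctor_comp {P : Type u} [Field P] {𝒰 : Type a} {σ : P ≃+* P}
    (e : ∀ X : Finset 𝒰, SemiLieEquiv σ (FreeLieAlgebra P X)) :
    conjFunctor e ⋙ conjFunctor (fun X => (e X).symm) = 𝟭 _ := by
  refine CategoryTheory.Functor.hext (fun _ => rfl) fun X Y f => heq_of_eq ?_
  exact SemiLieEquiv.conj_symm_conj (e X.vars) (e Y.vars) f

namespace AlgSetCat

variable {P : Type u} [Field P] {𝒰 : Type a} {H₁ : Type v} [LieRing H₁] [LieAlgebra P H₁]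
  {H₂ : Type w} [LieRing H₂] [LieAlgebra P H₂] {σ : P ≃+* P}
  {e : ∀ X : Finset 𝒰, SemiLieEquiv σ (FreeLieAlgebra P X)}

theorem PreservesClosure.inducedBy (he : PreservesClosure H₁ H₂ e) :
    InducedBy (twistFunctor H₁ H₂ e) (conjFunctor e) := by
  have hpts (X : Finset 𝒰) : solutions H₂ (Prod.map (e X) (e X) ''
      commonKer (Set.univ : Set (FreeLieAlgebra P X →ₗ⁅P⁆ H₁))) = Set.univ := by
    have h := he.pts_twistObj X ∅
    have h₁ : solutions (X := X) (P := P) H₁ ∅ = Set.univ := by simp [solutions]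
    have h₂ : solutions (X := X) (P := P) H₂ ∅ = Set.univ := by simp [solutions]
    rwa [Set.image_empty, h₁, h₂] at h
  refine CategoryTheory.Functor.hext (fun X => ?_) fun X Y f => ?_
  · simp only [Functor.comp_obj, affineSpace, twistFunctor, twistObj]
    congr
    exact hpts _
  · exact (heq_of_eq (twistFunctor_map_ofHom (V := aff H₁ X.unop.vars) (V' := aff H₁ Y.unop.vars)
      f.unop fun _ _ => Set.mem_univ _)).trans
      (heq_ofHom (hpts _) (hpts _) rfl _ fun _ _ => Set.mem_univ _)

theorem preservesIncl_twistFunctor : PreservesIncl (twistFunctor H₁ H₂ e) := by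
  rintro _ _ ⟨X, A, A', hA, hA', rfl, rfl, h⟩
  refine ⟨X, _, _, ⟨_, rfl⟩, ⟨_, rfl⟩, rfl, rfl, ?_⟩
  rintro μ hμ _ ⟨b, hb, rfl⟩
  exact hμ _ ⟨b, fun ν hν => hb ν (h hν), rfl⟩

end AlgSetCat

theorem TwistedGeomEquiv.exists_preservesClosure {P : Type u} [Field P] {𝒰 : Type a}
    {H₁ : Type v} [LieRing H₁] [LieAlgebra P H₁] {H₂ : Type w} [LieRing H₂] [LieAlgebra P H₂]
    (h : TwistedGeomEquiv P 𝒰 H₁ H₂) :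
    ∃ (σ : P ≃+* P) (e : ∀ X : Finset 𝒰, SemiLieEquiv σ (FreeLieAlgebra P X)),
      AlgSetCat.PreservesClosure H₁ H₂ e := by
  obtain ⟨σ, hσ⟩ := h
  refine ⟨σ, fun X => FreeLieAlgebra.scalarEquiv σ X, fun X T p q => ?_⟩
  rw [← hσ, SemiLieEquiv.mem_eqClosure_twist_iff]

theorem theorem5 {P : Type u} [Field P] (𝒰 : Type a) [Infinite 𝒰]
    (H₁ : Type v) [LieRing H₁] [LieAlgebra P H₁]
    (H₂ : Type w) [LieRing H₂] [LieAlgebra P H₂]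
    (h₁ : VarEqLie P H₁) (h₂ : VarEqLie P H₂) :
    List.TFAE
      [AreIsomorphic (AlgSetCat P 𝒰 H₁) (AlgSetCat P 𝒰 H₂),
        AreEquivalent (AlgSetCat P 𝒰 H₁) (AlgSetCat P 𝒰 H₂),
        TwistedGeomEquiv P 𝒰 H₁ H₂,
        CorrectlyIsomorphic P 𝒰 H₁ H₂,
        CorrectlyEquivalent P 𝒰 H₁ H₂] := by
  tfae_have 1 → 2 := fun ⟨F, G, hFG, hGF⟩ =>
    ⟨CategoryTheory.Equivalence.mk F G (eqToIso hFG.symm) (eqToIso hGF)⟩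
  tfae_have 2 → 3 := fun ⟨E⟩ => twistedGeomEquiv_of_equivalence h₁ h₂ E
  tfae_have 3 → 4 := by
    intro h
    obtain ⟨σ, e, he⟩ := h.exists_preservesClosure
    exact ⟨_, _, _, _, ⟨he.twistFunctor_comp, he.symm.twistFunctor_comp⟩,
      ⟨conjFunctor_comp e, conjFunctor_comp fun X => (e X).symm⟩, he.inducedBy,
      AlgSetCat.preservesIncl_twistFunctor⟩
  tfae_have 4 → 1 := fun ⟨F, G, _, _, h, _⟩ => ⟨F, G, h⟩
  tfae_have 3 → 5 := by
    intro h
    obtain ⟨σ, e, he⟩ := h.exists_preservesClosure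
    exact ⟨CategoryTheory.Equivalence.mk _ _ (eqToIso he.twistFunctor_comp.symm)
        (eqToIso he.symm.twistFunctor_comp),
      CategoryTheory.Equivalence.mk _ _ (eqToIso (conjFunctor_comp e).symm)
        (eqToIso (conjFunctor_comp fun X => (e X).symm)),
      he.inducedBy, he.symm.inducedBy, AlgSetCat.preservesIncl_twistFunctor,
      AlgSetCat.preservesIncl_twistFunctor⟩
  tfae_have 5 → 2 := fun ⟨E, _⟩ => ⟨E⟩
  tfae_finish
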